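/- Let $k$ be a field. An ideal of $S=k[x_1,\dots,x_n]$ is a monomial ideal if it is generated by monomials; it is squarefree if moreover all its minimal monomial generators are squarefree. For a homogeneous ideal $I\subseteq S$ let $I_d$ be the $k$-space of forms of degree $d$ in $I$, and let $\mathbf m_1 I_d$ be the $k$-span of the products $x_i f$ with $1\le i\le n$ and $f\in I_d$. The ideal $I$ is Gotzmann if, for all $d\ge 0$ and all homogeneous ideals $J\subseteq S$ with $\dim_k I_d=\dim_k J_d$, one has $\dim_k \mathbf m_1 I_d\le\dim_k\mathbf m_1 J_d$. A monomial ideal of $k[x_1,\dots,x_n]$ has full support if each of the $n$ variables divides at least one of its minimal monomial generators. Let $\mathsf H$ be the set of all squarefree Gotzmann ideals with full support in the polynomial rings $k[x_1,\dots,x_n]$, $n\ge 0$ (for $n=0$ both the zero ideal and the unit ideal of $k$ belong to $\mathsf H$), and for $I\in\mathsf H$ with $I\subseteq k[x_1,\dots,x_n]$ put $\omega(I)=n$. Then for every $n$ there are only finitely many $I\in\mathsf H$ with $\omega(I)=n$, and the exponential generating function of $\mathsf H$ with weight $\omega$ is, as a formal power series over $\mathbb Q$, \[ h(t)=\sum_{I\in\mathsf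 H}\frac{t^{\omega(I)}}{\omega(I)!}=\frac{2(1-t)}{2-e^t}+t. \] -/

import Mathlib

namespace GotzmannEGF

open MvPolynomial

attribute [local instance] MvPolynomial.gradedAlgebra

/-- The polynomial ring `k[x₁, …, xₙ]`. -/
abbrev PolyRing (k : Type*) [Field k] (n : ℕ) : Type _ := MvPolynomial (Fin n) k

/-- The degree `d` component `I_d` of an ideal: the `k`-space of all forms of degree `d` in `I`. -/
noncomputable def component {k : Type*} [Field k] {n : ℕ} (I : Ideal (PolyRing k n)) (d : ℕ) :
    Submodule k (PolyRing k n) :=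
  I.restrictScalars k ⊓ homogeneousSubmodule (Fin n) k d

/-- `m₁ V`: the `k`-span of all products `ℓ * v` with `ℓ` a linear form and `v ∈ V`
(equivalently, of all `x_i * v`). -/
noncomputable def linearMul {k : Type*} [Field k] {n : ℕ} (V : Submodule k (PolyRing k n)) :
    Submodule k (PolyRing k n) :=
  homogeneousSubmodule (Fin n) k 1 * V

/-- A homogeneous ideal `I` is Gotzmann if `|m₁ I_d| ≤ |m₁ J_d|` for every degree `d` and every
homogeneous ideal `J` with `|I_d| = |J_d|`, where `|·|` is the dimension over `k`. All spaces
involved are finite-dimensional. -/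
def IsGotzmann {k : Type*} [Field k] {n : ℕ} (I : Ideal (PolyRing k n)) : Prop :=
  I.IsHomogeneous (homogeneousSubmodule (Fin n) k) ∧
    ∀ (d : ℕ) (J : Ideal (PolyRing k n)),
      J.IsHomogeneous (homogeneousSubmodule (Fin n) k) →
      Module.finrank k (component I d) = Module.finrank k (component J d) →
      Module.finrank k (linearMul (component I d)) ≤ Module.finrank k (linearMul (component J d))

/-- A monomial ideal: an ideal generated by a set of monomials, given by their exponents. -/
def IsMonomialIdeal {k : Type*} [Field k] {n : ℕ} (I : Ideal (PolyRing k n)) : Prop :=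
  ∃ A : Set (Fin n →₀ ℕ), I = Ideal.span ((fun a => monomial a (1 : k)) '' A)

/-- The exponents of the canonical minimal monomial generators of a monomial ideal `I`: the
monomials in `I` that are minimal with respect to divisibility. -/
def gens {k : Type*} [Field k] {n : ℕ} (I : Ideal (PolyRing k n)) : Set (Fin n →₀ ℕ) :=
  {a | Minimal (fun b => monomial b (1 : k) ∈ I) a}

/-- A squarefree ideal: a monomial ideal all of whose minimal generators are squarefree. -/
def IsSquarefreeIdeal {k : Type*} [Field k] {n : ℕ} (I : Ideal (PolyRing k n)) : Prop :=
  IsMonomialIdeal I ∧ ∀ a ∈ gens I, ∀ i, a i ≤ 1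

/-- Full support: each of the `n` variables divides some minimal generator of `I`. -/
def HasFullSupport {k : Type*} [Field k] {n : ℕ} (I : Ideal (PolyRing k n)) : Prop :=
  ∀ i : Fin n, ∃ a ∈ gens I, i ∈ a.support

/-- The set of all squarefree Gotzmann ideals with full support in the polynomial rings
`k[x₁, …, xₙ]`, for all `n ≥ 0`. -/
def fullSupportGotzmann (k : Type*) [Field k] : Set (Σ n : ℕ, Ideal (PolyRing k n)) :=
  {I | IsSquarefreeIdeal I.2 ∧ IsGotzmann I.2 ∧ HasFullSupport I.2}

/-- The weight of an ideal of `k[x₁, …, xₙ]` is the number `n` of variables. -/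
def weight {k : Type*} [Field k] (I : Σ n : ℕ, Ideal (PolyRing k n)) : ℕ := I.1

/-- The exponential generating function `∑_{a ∈ A} t^{w a} / (w a)!` of a set `A` with a weight
function `w` all of whose fibres in `A` are finite: the coefficient of `tⁿ` is the number of
elements of weight `n` divided by `n!`. -/
noncomputable def egf {α : Type*} (A : Set α) (w : α → ℕ) : PowerSeries ℚ :=
  PowerSeries.mk fun n => ({a ∈ A | w a = n}.ncard : ℚ) / (n.factorial : ℚ)

end GotzmannEGF

/-! ### Numerical functions attached to lexicographic segments. -/

namespace GotzmannEGF

/-! A squarefree ideal is determined by the up-set `U` of supports of its monomials, so the problem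
becomes one of counting exponents. Macaulay's theorem bounds the shadow of `a` monomials of degree
`d` in `n` variables below by `lexGrowth n d a`, the value for a lexicographic segment; leading
monomials extend the bound to spaces of forms. Hence Gotzmann means that every layer attains the
bound, over any field (`isGotzmann_squarefreeIdeal_iff`). Macaulay's bound is proved by compressing
to a set stable under exchanging one variable `x` for any other. The shadow of a stable set `A` has
size `|A|` plus that of the shadow of its `x`-free part in the other variables, and Green's bound
controls the `x`-free part. Both bounds go by induction on the number of variables.

The central comparison is `GotzmannOn.card_add_card_le`. Split a layer of a Gotzmann ideal into its
`x`-free part and `x` times the colon by `x`, and rearrange both parts lexicographically without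
changing sizes. The rearranged set cannot have a smaller shadow, so Macaulay's bounds for the parts
must be equalities. Consequently the restriction to the other variables is Gotzmann, so is the
restricted colon, and the two are tightly related (`GotzmannOn.subset_or`). By induction, a Gotzmann
ideal other than 0 and 1 contains a variable or is divisible by one (`GotzmannOn.cases`): in a
minimal counterexample every variable lies in an edge and in a two-element vertex cover, and this
leads to a star-like ideal or a 4-cycle, both of which grow too fast, or to a direct contradiction.
So the squarefree Gotzmann ideals are exactly those built from 0 and 1 by multiplying by, or adding,
new variables (`GotzmannClass`).

For counting, let `l n` be the number of such ideals with support of size `n` that contain no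
variable and are not the unit ideal. Alexander duality exchanges them with the nonzero ideals whose
members have no common variable. For `n ≠ 1` every ideal is of exactly one of the two kinds, so the
total is `2 * l n`; for `n = 1` there is just one ideal. For `n ≥ 2`, splitting off the nonempty set
of common variables gives `l n = ∑ j < n, n.choose j * l j`. With `l 0 = 1` and `l 1 = 0` the
exponential generating function `L` of `l` satisfies `L * (2 - exp) = 1 - X`, and the answer is `2 *
L + X`. -/

/-- The size of the upper shadow of a lexicographic segment of `a` monomials of degree `d` in `n`
variables. -/
def lexGrowth : ℕ → ℕ → ℕ → ℕ
  | n, 0, a => if a = 0 then 0 else n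
  | 0, _ + 1, _ => 0
  | n + 1, d + 1, a =>
    lexGrowth (n + 1) d (min a (Nat.multichoose (n + 1) d)) +
      lexGrowth n (d + 1) (a - Nat.multichoose (n + 1) d)

/-- The number of monomials not divisible by the last variable in a lexicographic segment of `a`
monomials of degree `d` in `n + 1` variables. -/
def lexRestrict : ℕ → ℕ → ℕ → ℕ
  | _, 0, a => min a 1
  | 0, _ + 1, _ => 0
  | n + 1, d + 1, a =>
    lexRestrict (n + 1) d (min a (Nat.multichoose (n + 2) d)) +
      lexRestrict n (d + 1) (a - Nat.multichoose (n + 2) d)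

theorem lexGrowth_deg_zero (n a : ℕ) : lexGrowth n 0 a = if a = 0 then 0 else n := by
  cases n <;> simp [lexGrowth]

theorem lexGrowth_zero_vars (d a : ℕ) : lexGrowth 0 d a = 0 := by
  cases d <;> simp [lexGrowth]

theorem lexGrowth_succ_succ (n d a : ℕ) : lexGrowth (n + 1) (d + 1) a =
    lexGrowth (n + 1) d (min a (Nat.multichoose (n + 1) d)) +
      lexGrowth n (d + 1) (a - Nat.multichoose (n + 1) d) := by
  simp [lexGrowth]

theorem lexRestrict_deg_zero (n a : ℕ) : lexRestrict n 0 a = min a 1 := by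
  cases n <;> simp [lexRestrict]

theorem lexRestrict_zero_vars (d a : ℕ) : lexRestrict 0 (d + 1) a = 0 := by
  simp [lexRestrict]

theorem lexRestrict_succ_succ (n d a : ℕ) : lexRestrict (n + 1) (d + 1) a =
    lexRestrict (n + 1) d (min a (Nat.multichoose (n + 2) d)) +
      lexRestrict n (d + 1) (a - Nat.multichoose (n + 2) d) := by
  simp [lexRestrict]

theorem multichoose_succ_succ' (n d : ℕ) : Nat.multichoose (n + 1) (d + 1) =
    Nat.multichoose (n + 1) d + Nat.multichoose n (d + 1) := by
  rw [Nat.multichoose_succ_succ, add_comm]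

theorem multichoose_add_two_succ (n d : ℕ) : Nat.multichoose (n + 2) (d + 1) =
    Nat.multichoose (n + 2) d + Nat.multichoose (n + 1) (d + 1) :=
  multichoose_succ_succ' (n + 1) d

/-- Induction along the recursion defining `lexGrowth`. -/
theorem two_rec {P : ℕ → ℕ → Prop} (h0 : ∀ n, P n 0) (h1 : ∀ d, P 0 (d + 1))
    (h2 : ∀ n d, P (n + 1) d → P n (d + 1) → P (n + 1) (d + 1)) (n d : ℕ) : P n d := by
  induction n generalizing d with
  | zero => cases d with
    | zero => exact h0 0
    | succ d => exact h1 d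
  | succ n ihn =>
    induction d with
    | zero => exact h0 _
    | succ d ihd => exact h2 n d ihd (ihn _)

theorem lexGrowth_zero (n d : ℕ) : lexGrowth n d 0 = 0 := by
  refine two_rec (P := fun n d => lexGrowth n d 0 = 0) ?_ ?_ ?_ n d
  · intro n; simp [lexGrowth_deg_zero]
  · intro d; simp [lexGrowth_zero_vars]
  · intro n d h1 h2; simp [lexGrowth_succ_succ, h1, h2]

theorem lexGrowth_full (n d : ℕ) :
    lexGrowth n d (Nat.multichoose n d) = Nat.multichoose n (d + 1) := by
  refine two_rec
    (P := fun n d => lexGrowth n d (Nat.multichoose n d) = Nat.multichoose n (d + 1)) ?_ ?_ ?_ n d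
  · intro n; simp [lexGrowth_deg_zero]
  · intro d; simp [lexGrowth_zero_vars]
  · intro n d h1 h2
    rw [lexGrowth_succ_succ, multichoose_succ_succ' n (d + 1), multichoose_succ_succ' n d,
      min_eq_right (by omega), Nat.add_sub_cancel_left, h1, h2, multichoose_succ_succ' n d]

theorem lexGrowth_mono (n d : ℕ) : Monotone (lexGrowth n d) := by
  refine two_rec (P := fun n d => Monotone (lexGrowth n d)) ?_ ?_ ?_ n d
  · intro n a b hab
    simp only [lexGrowth_deg_zero]; split_ifs <;> omega
  · intro d a b hab; simp [lexGrowth_zero_vars]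
  · intro n d h1 h2 a b hab
    simp only [lexGrowth_succ_succ]
    exact Nat.add_le_add (h1 (by omega)) (h2 (by omega))

theorem lexGrowth_le (n d a : ℕ) : lexGrowth n d a ≤ Nat.multichoose n (d + 1) := by
  revert a
  refine two_rec (P := fun n d => ∀ a, lexGrowth n d a ≤ Nat.multichoose n (d + 1)) ?_ ?_ ?_ n d
  · intro n a; simp only [lexGrowth_deg_zero]; split_ifs <;> simp
  · intro d a; simp [lexGrowth_zero_vars]
  · intro n d h1 h2 a
    rw [lexGrowth_succ_succ, multichoose_succ_succ' n (d + 1)]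
    exact Nat.add_le_add (h1 _) (h2 _)

/-- A segment this short consists of multiples of the first variable, and dividing by that variable
leaves a segment one degree lower. -/
theorem lexGrowth_succ_deg {n d a : ℕ} (h : a ≤ Nat.multichoose n d) :
    lexGrowth n (d + 1) a = lexGrowth n d a := by
  cases n with
  | zero => simp [lexGrowth_zero_vars]
  | succ n => rw [lexGrowth_succ_succ, min_eq_left h, Nat.sub_eq_zero_of_le h, lexGrowth_zero,
      add_zero]

theorem lexGrowth_add (n d b : ℕ) :
    lexGrowth (n + 1) (d + 1) (Nat.multichoose (n + 1) d + b) =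
      Nat.multichoose (n + 1) (d + 1) + lexGrowth n (d + 1) b := by
  rw [lexGrowth_succ_succ, min_eq_right (by omega), lexGrowth_full, Nat.add_sub_cancel_left]

theorem lexRestrict_zero (n d : ℕ) : lexRestrict n d 0 = 0 := by
  refine two_rec (P := fun n d => lexRestrict n d 0 = 0) ?_ ?_ ?_ n d
  · intro n; simp [lexRestrict_deg_zero]
  · intro d; simp [lexRestrict_zero_vars]
  · intro n d h1 h2; simp [lexRestrict_succ_succ, h1, h2]

theorem lexRestrict_full (n d : ℕ) :
    lexRestrict n d (Nat.multichoose (n + 1) d) = Nat.multichoose n d := by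
  refine two_rec
    (P := fun n d => lexRestrict n d (Nat.multichoose (n + 1) d) = Nat.multichoose n d) ?_ ?_ ?_ n d
  · intro n; simp [lexRestrict_deg_zero]
  · intro d; simp [lexRestrict_zero_vars]
  · intro n d h1 h2
    rw [lexRestrict_succ_succ, multichoose_succ_succ' n d, multichoose_add_two_succ n d,
      min_eq_right (by omega), Nat.add_sub_cancel_left, h1, h2]

theorem lexRestrict_mono (n d : ℕ) : Monotone (lexRestrict n d) := by
  refine two_rec (P := fun n d => Monotone (lexRestrict n d)) ?_ ?_ ?_ n d
  · intro n a b hab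
    simp only [lexRestrict_deg_zero]; omega
  · intro d a b hab; simp [lexRestrict_zero_vars]
  · intro n d h1 h2 a b hab
    simp only [lexRestrict_succ_succ]
    exact Nat.add_le_add (h1 (by omega)) (h2 (by omega))

theorem lexRestrict_le (n d a : ℕ) : lexRestrict n d a ≤ Nat.multichoose n d := by
  revert a
  refine two_rec (P := fun n d => ∀ a, lexRestrict n d a ≤ Nat.multichoose n d) ?_ ?_ ?_ n d
  · intro n a; simp [lexRestrict_deg_zero]
  · intro d a; simp [lexRestrict_zero_vars]
  · intro n d h1 h2 a
    rw [lexRestrict_succ_succ, multichoose_succ_succ' n d]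
    exact Nat.add_le_add (h1 _) (h2 _)

theorem lexRestrict_le_self (n d a : ℕ) : lexRestrict n d a ≤ a := by
  revert a
  refine two_rec (P := fun n d => ∀ a, lexRestrict n d a ≤ a) ?_ ?_ ?_ n d
  · intro n a; simp [lexRestrict_deg_zero]
  · intro d a; simp [lexRestrict_zero_vars]
  · intro n d h1 h2 a
    rw [lexRestrict_succ_succ]
    have := h1 (min a (Nat.multichoose (n + 2) d))
    have := h2 (a - Nat.multichoose (n + 2) d)
    omega

theorem lexRestrict_succ_deg {n d a : ℕ} (h : a ≤ Nat.multichoose (n + 2) d) :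
    lexRestrict (n + 1) (d + 1) a = lexRestrict (n + 1) d a := by
  rw [lexRestrict_succ_succ, min_eq_left h, Nat.sub_eq_zero_of_le h, lexRestrict_zero, add_zero]

theorem lexRestrict_add (n d b : ℕ) :
    lexRestrict (n + 1) (d + 1) (Nat.multichoose (n + 2) d + b) =
      Nat.multichoose (n + 1) d + lexRestrict n (d + 1) b := by
  rw [lexRestrict_succ_succ, min_eq_right (by omega), lexRestrict_full, Nat.add_sub_cancel_left]

/-- The monomials of the segment divisible by the last variable number at most all monomials one
degree lower. -/
theorem le_add_lexRestrict (n d : ℕ) : ∀ a ≤ Nat.multichoose (n + 1) (d + 1),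
    a ≤ Nat.multichoose (n + 1) d + lexRestrict n (d + 1) a := by
  induction n generalizing d with
  | zero => intro a ha; simpa [lexRestrict_zero_vars] using ha
  | succ n ih =>
    intro a ha
    rw [multichoose_add_two_succ n d] at ha
    rcases le_or_gt a (Nat.multichoose (n + 2) d) with h | h
    · exact le_add_right h
    · obtain ⟨b, rfl⟩ := Nat.exists_eq_add_of_le h.le
      rw [lexRestrict_add]
      have := ih d b (by omega)
      rw [show n + 1 + 1 = n + 2 from rfl]
      omega

/-- Lexicographic segments are stable for the last variable `z`: the shadow is `z` times the segment
together with the shadow, in the other variables, of the `z`-free part. -/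
theorem lexGrowth_eq_add_lexRestrict (n d : ℕ) : ∀ a ≤ Nat.multichoose (n + 1) d,
    lexGrowth (n + 1) d a = a + lexGrowth n d (lexRestrict n d a) := by
  refine two_rec (P := fun n d => ∀ a ≤ Nat.multichoose (n + 1) d,
    lexGrowth (n + 1) d a = a + lexGrowth n d (lexRestrict n d a)) ?_ ?_ ?_ n d
  · intro n a ha
    simp only [Nat.multichoose_zero_right] at ha
    interval_cases a <;> simp [lexGrowth_deg_zero, lexRestrict_deg_zero, add_comm]
  · intro d
    induction d with
    | zero =>
      intro a ha
      rw [Nat.multichoose_one] at ha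
      rw [lexGrowth_zero_vars, lexGrowth_succ_deg (by simpa using ha), lexGrowth_deg_zero]
      interval_cases a <;> simp
    | succ d ih =>
      intro a ha
      rw [Nat.multichoose_one] at ha
      rw [lexGrowth_zero_vars, lexGrowth_succ_deg (by simpa using ha), ih a (by simpa using ha),
        lexGrowth_zero_vars]
  · intro n d h1 h2 a ha
    rw [multichoose_add_two_succ n d] at ha
    rcases le_or_gt a (Nat.multichoose (n + 2) d) with h | h
    · rw [lexGrowth_succ_deg h, h1 a h, lexRestrict_succ_deg h,
        lexGrowth_succ_deg (lexRestrict_le _ _ _)]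
    · obtain ⟨b, rfl⟩ := Nat.exists_eq_add_of_le h.le
      rw [lexRestrict_add, lexGrowth_add, lexGrowth_add, h2 b (by omega),
        multichoose_add_two_succ n d]
      omega

/-- The arithmetic behind Green's bound. If the `z`-free part were below its lexicographic size,
division by `z` would leave at least `a - lexRestrict n (d + 1) a + 1` monomials; the inequality
says that so many already force a `z`-free part of the full size. -/
theorem lexRestrict_le_lexGrowth (n d : ℕ) : ∀ a ≤ Nat.multichoose (n + 1) (d + 1),
    a - lexRestrict n (d + 1) a + 1 ≤ Nat.multichoose (n + 1) d →
    lexRestrict n (d + 1) a ≤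
      lexGrowth n d (lexRestrict n d (a - lexRestrict n (d + 1) a + 1)) := by
  induction n generalizing d with
  | zero => intro a _ _; simp [lexRestrict_zero_vars]
  | succ n ihn =>
    induction d with
    | zero =>
      intro a ha hb
      rw [Nat.multichoose_zero_right] at hb
      have h0 : a - lexRestrict (n + 1) (0 + 1) a = 0 := by omega
      rw [h0, lexRestrict_deg_zero, lexGrowth_deg_zero]
      simpa using lexRestrict_le (n + 1) 1 a
    | succ d ihd =>
      intro a ha hb
      rw [multichoose_add_two_succ n (d + 1)] at ha
      have h2 := multichoose_add_two_succ n d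
      rcases le_or_gt a (Nat.multichoose (n + 2) (d + 1)) with h | h
      · rw [lexRestrict_succ_deg h] at hb ⊢
        set l := lexRestrict (n + 1) (d + 1) a with hl
        have hle := le_add_lexRestrict (n + 1) d a h
        rcases le_or_gt (a - l + 1) (Nat.multichoose (n + 2) d) with hc | hc
        · rw [lexRestrict_succ_deg hc, lexGrowth_succ_deg (lexRestrict_le _ _ _)]
          exact ihd a h hc
        -- `le_add_lexRestrict` bounds `a - l` by the full block, so only this boundary value
        -- remains; its growth contains all monomials counted by the upper bound on `l`.
        · have he : a - l + 1 = Nat.multichoose (n + 2) d + 1 := by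
            simp only [show n + 1 + 1 = n + 2 from rfl] at hle; omega
          rw [he, lexRestrict_add, lexGrowth_add]
          exact (lexRestrict_le _ _ _).trans (Nat.le_add_right _ _)
      · obtain ⟨b, rfl⟩ := Nat.exists_eq_add_of_le h.le
        rw [show n + 1 + 1 = n + 2 from rfl] at hb
        rw [lexRestrict_add] at hb ⊢
        have hs := lexRestrict_le_self n (d + 1 + 1) b
        have h3 := multichoose_succ_succ' n (d + 1)
        have h4 := multichoose_add_two_succ n d
        have he : Nat.multichoose (n + 2) (d + 1) + b -
            (Nat.multichoose (n + 1) (d + 1) + lexRestrict n (d + 1 + 1) b) + 1 =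
            Nat.multichoose (n + 2) d + (b - lexRestrict n (d + 1 + 1) b + 1) := by
          omega
        rw [he] at hb ⊢
        rw [lexRestrict_add, lexGrowth_add]
        exact Nat.add_le_add_left (ihn (d + 1) b (by omega) (by omega)) _

end GotzmannEGF

/-! ### Sets of monomials, their shadows, and stability. -/

namespace GotzmannEGF

open Finset

section Monomials

variable {ι : Type*}

theorem exists_eq_add_single {a : ι →₀ ℕ} {x : ι} (h : a x ≠ 0) :
    ∃ b, a = b + .single x 1 := by
  refine ⟨a - .single x 1, (tsub_add_cancel_of_le ?_).symm⟩
  simpa [Finsupp.single_le_iff] using Nat.one_le_iff_ne_zero.2 h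

/-- The monomials of `A` not divisible by `x`. -/
def without (x : ι) (A : Finset (ι →₀ ℕ)) : Finset (ι →₀ ℕ) := A.filter fun a => a x = 0

theorem mem_without {x : ι} {A : Finset (ι →₀ ℕ)} {a : ι →₀ ℕ} :
    a ∈ without x A ↔ a ∈ A ∧ a x = 0 := by simp [without]

variable [DecidableEq ι]

/-- The exponents of the monomials of degree `d` in the variables in `V`. -/
abbrev mons (V : Finset ι) (d : ℕ) : Finset (ι →₀ ℕ) := V.finsuppAntidiag d

theorem mem_mons {V : Finset ι} {d : ℕ} {a : ι →₀ ℕ} :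
    a ∈ mons V d ↔ a.degree = d ∧ a.support ⊆ V :=
  Finset.mem_finsuppAntidiag'

theorem card_mons (V : Finset ι) (d : ℕ) : #(mons V d) = Nat.multichoose #V d :=
  Finset.card_finsuppAntidiag_nat_eq_multichoose d

theorem mons_zero (V : Finset ι) : mons V 0 = {0} := Finset.finsuppAntidiag_zero V

theorem card_le_multichoose {V : Finset ι} {d : ℕ} {A : Finset (ι →₀ ℕ)} (h : A ⊆ mons V d) :
    #A ≤ Nat.multichoose #V d := by
  rw [← card_mons]; exact card_le_card h

theorem add_single_mem_mons {V : Finset ι} {d : ℕ} {a : ι →₀ ℕ} {i : ι} (hi : i ∈ V) :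
    a + .single i 1 ∈ mons V (d + 1) ↔ a ∈ mons V d := by
  simp only [mem_mons, map_add, Finsupp.degree_single, add_left_inj]
  refine and_congr_right fun _ => ⟨fun h j hj => h ?_, fun h j hj => ?_⟩
  · simp only [Finsupp.mem_support_iff, Finsupp.add_apply] at hj ⊢
    omega
  · by_cases hji : i = j
    · exact hji ▸ hi
    · apply h
      simpa [Finsupp.single_apply, hji] using hj

theorem mem_mons_erase {V : Finset ι} {d : ℕ} {a : ι →₀ ℕ} {x : ι} :
    a ∈ mons (V.erase x) d ↔ a ∈ mons V d ∧ a x = 0 := by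
  simp only [mem_mons, subset_erase, Finsupp.notMem_support_iff]
  tauto

/-- The upper shadow of a set of monomials: all products with a variable in `V`. -/
noncomputable def upShadow (V : Finset ι) (A : Finset (ι →₀ ℕ)) : Finset (ι →₀ ℕ) :=
  (A ×ˢ V).image fun p => p.1 + .single p.2 1

theorem mem_upShadow {V : Finset ι} {A : Finset (ι →₀ ℕ)} {c : ι →₀ ℕ} :
    c ∈ upShadow V A ↔ ∃ a ∈ A, ∃ i ∈ V, a + .single i 1 = c := by
  simp only [upShadow, mem_image, mem_product, Prod.exists]
  constructor
  · rintro ⟨a, i, ⟨ha, hi⟩, h⟩; exact ⟨a, ha, i, hi, h⟩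
  · rintro ⟨a, ha, i, hi, h⟩; exact ⟨a, i, ⟨ha, hi⟩, h⟩

theorem add_single_mem_upShadow {V : Finset ι} {A : Finset (ι →₀ ℕ)} {a : ι →₀ ℕ} {i : ι}
    (ha : a ∈ A) (hi : i ∈ V) : a + .single i 1 ∈ upShadow V A :=
  mem_upShadow.2 ⟨a, ha, i, hi, rfl⟩

theorem upShadow_subset_mons {V : Finset ι} {A : Finset (ι →₀ ℕ)} {d : ℕ} (h : A ⊆ mons V d) :
    upShadow V A ⊆ mons V (d + 1) := by
  intro c hc
  obtain ⟨a, ha, i, hi, rfl⟩ := mem_upShadow.1 hc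
  exact (add_single_mem_mons hi).2 (h ha)

theorem upShadow_union (V : Finset ι) (A B : Finset (ι →₀ ℕ)) :
    upShadow V (A ∪ B) = upShadow V A ∪ upShadow V B := by
  simp only [upShadow, union_product, image_union]

@[simp] theorem upShadow_empty (V : Finset ι) : upShadow V ∅ = ∅ := by simp [upShadow]

theorem upShadow_mons (V : Finset ι) (d : ℕ) : upShadow V (mons V d) = mons V (d + 1) := by
  refine (upShadow_subset_mons subset_rfl).antisymm fun c hc => ?_
  have h0 : c ≠ 0 := by rintro rfl; simp at hc
  obtain ⟨i, hi⟩ := Finsupp.support_nonempty_iff.2 h0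
  obtain ⟨b, rfl⟩ := exists_eq_add_single (Finsupp.mem_support_iff.1 hi)
  have hiV := (mem_mons.1 hc).2 hi
  exact add_single_mem_upShadow ((add_single_mem_mons hiV).1 hc) hiV

theorem without_subset_mons {V : Finset ι} {d : ℕ} {x : ι} {A : Finset (ι →₀ ℕ)}
    (h : A ⊆ mons V d) : without x A ⊆ mons (V.erase x) d := fun _ ha =>
  mem_mons_erase.2 ⟨h (mem_without.1 ha).1, (mem_without.1 ha).2⟩

/-- The products of the monomials in `A` with `x`. -/
noncomputable def mulVar (x : ι) (A : Finset (ι →₀ ℕ)) : Finset (ι →₀ ℕ) :=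
  A.image fun a => a + .single x 1

theorem add_single_mem_mulVar {x : ι} {A : Finset (ι →₀ ℕ)} {a : ι →₀ ℕ} :
    a + .single x 1 ∈ mulVar x A ↔ a ∈ A := by simp [mulVar]

theorem mem_mulVar {x : ι} {A : Finset (ι →₀ ℕ)} {c : ι →₀ ℕ} :
    c ∈ mulVar x A ↔ ∃ a ∈ A, a + .single x 1 = c := by simp [mulVar]

theorem ne_zero_of_mem_mulVar {x : ι} {A : Finset (ι →₀ ℕ)} {c : ι →₀ ℕ} (h : c ∈ mulVar x A) :
    c x ≠ 0 := by
  obtain ⟨a, -, rfl⟩ := mem_mulVar.1 h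
  simp

@[simp] theorem card_mulVar (x : ι) (A : Finset (ι →₀ ℕ)) : #(mulVar x A) = #A :=
  card_image_of_injective _ (add_left_injective _)

theorem mulVar_union (x : ι) (A B : Finset (ι →₀ ℕ)) :
    mulVar x (A ∪ B) = mulVar x A ∪ mulVar x B := image_union _ _

theorem mulVar_mono {x : ι} {A B : Finset (ι →₀ ℕ)} (h : A ⊆ B) : mulVar x A ⊆ mulVar x B :=
  image_subset_image h

theorem mulVar_subset_mons {V : Finset ι} {d : ℕ} {x : ι} (hx : x ∈ V) {A : Finset (ι →₀ ℕ)}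
    (h : A ⊆ mons V d) : mulVar x A ⊆ mons V (d + 1) := by
  intro c hc
  obtain ⟨a, ha, rfl⟩ := mem_mulVar.1 hc
  exact (add_single_mem_mons hx).2 (h ha)

theorem mulVar_subset_upShadow {V : Finset ι} {x : ι} (hx : x ∈ V) (A : Finset (ι →₀ ℕ)) :
    mulVar x A ⊆ upShadow V A := by
  intro c hc
  obtain ⟨a, ha, rfl⟩ := mem_mulVar.1 hc
  exact add_single_mem_upShadow ha hx

theorem upShadow_eq_union_mulVar {V : Finset ι} {x : ι} (hx : x ∈ V) (C : Finset (ι →₀ ℕ)) :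
    upShadow V C = upShadow (V.erase x) C ∪ mulVar x C := by
  ext c
  rw [mem_union]
  constructor
  · intro hc
    obtain ⟨a, ha, i, hi, rfl⟩ := mem_upShadow.1 hc
    by_cases hix : i = x
    · subst hix; exact .inr (add_single_mem_mulVar.2 ha)
    · exact .inl (add_single_mem_upShadow ha (mem_erase.2 ⟨hix, hi⟩))
  · rintro (hc | hc)
    · obtain ⟨a, ha, i, hi, rfl⟩ := mem_upShadow.1 hc
      exact add_single_mem_upShadow ha (mem_erase.1 hi).2
    · exact mulVar_subset_upShadow hx _ hc

theorem upShadow_mulVar (V : Finset ι) (x : ι) (A : Finset (ι →₀ ℕ)) :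
    upShadow V (mulVar x A) = mulVar x (upShadow V A) := by
  ext c
  simp only [mem_upShadow, mem_mulVar]
  constructor
  · rintro ⟨_, ⟨a, ha, rfl⟩, i, hi, rfl⟩
    exact ⟨_, ⟨a, ha, i, hi, rfl⟩, add_right_comm _ _ _⟩
  · rintro ⟨_, ⟨a, ha, i, hi, rfl⟩, rfl⟩
    exact ⟨_, ⟨a, ha, rfl⟩, i, hi, add_right_comm _ _ _⟩

theorem disjoint_mulVar {V : Finset ι} {d : ℕ} {x : ι} {C : Finset (ι →₀ ℕ)}
    (hC : C ⊆ mons (V.erase x) d) (E : Finset (ι →₀ ℕ)) : Disjoint C (mulVar x E) := by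
  rw [disjoint_left]
  exact fun a ha hb => ne_zero_of_mem_mulVar hb (mem_mons_erase.1 (hC ha)).2

/-- `A` is closed under replacing one factor `x` by another variable in `V`. -/
def IsStable (V : Finset ι) (x : ι) (A : Finset (ι →₀ ℕ)) : Prop :=
  ∀ b, b + .single x 1 ∈ A → ∀ i ∈ V, b + .single i 1 ∈ A

/-- A product `b * x * i` of a member with a variable is also `x` times the member `b * i`, so new
`x`-free monomials come only from the `x`-free part. -/
theorem IsStable.upShadow_eq {V : Finset ι} {x : ι} (hx : x ∈ V) {A : Finset (ι →₀ ℕ)}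
    (h : IsStable V x A) :
    upShadow V A = upShadow (V.erase x) (without x A) ∪ mulVar x A := by
  ext c
  rw [mem_union]
  constructor
  · intro hc
    obtain ⟨a, ha, i, hi, rfl⟩ := mem_upShadow.1 hc
    by_cases hax : a x = 0
    · by_cases hix : i = x
      · subst hix; exact .inr (add_single_mem_mulVar.2 ha)
      · exact .inl (add_single_mem_upShadow (mem_without.2 ⟨ha, hax⟩) (mem_erase.2 ⟨hix, hi⟩))
    · obtain ⟨b, rfl⟩ := exists_eq_add_single hax
      right
      rw [add_right_comm]
      exact add_single_mem_mulVar.2 (h b ha i hi)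
  · rintro (hc | hc)
    · obtain ⟨a, ha, i, hi, rfl⟩ := mem_upShadow.1 hc
      exact add_single_mem_upShadow (mem_without.1 ha).1 (mem_erase.1 hi).2
    · exact mulVar_subset_upShadow hx _ hc

theorem IsStable.card_upShadow {V : Finset ι} {x : ι} (hx : x ∈ V) {A : Finset (ι →₀ ℕ)} {d : ℕ}
    (hA : A ⊆ mons V d) (h : IsStable V x A) :
    #(upShadow V A) = #A + #(upShadow (V.erase x) (without x A)) := by
  rw [h.upShadow_eq hx, card_union_of_disjoint, card_mulVar, add_comm]
  exact disjoint_mulVar (upShadow_subset_mons (without_subset_mons hA)) _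

/-- The upper shadow of `C ∪ x E`, for `C` without `x` and `E` stable. -/
theorem IsStable.card_upShadow_union_mulVar {V : Finset ι} {x : ι} (hx : x ∈ V)
    {C E : Finset (ι →₀ ℕ)} {d : ℕ} (hC : C ⊆ mons (V.erase x) (d + 1)) (hE : E ⊆ mons V d)
    (h : IsStable V x E) :
    #(upShadow V (C ∪ mulVar x E)) =
      #(upShadow (V.erase x) C) + #(C ∪ upShadow (V.erase x) (without x E)) + #E := by
  have hU := upShadow_subset_mons (without_subset_mons (x := x) hE)
  -- With `E₀` the `x`-free part of `E` and `∂` the shadow in the other variables, the shadow is the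
  -- disjoint union of `∂C`, `x (C ∪ ∂E₀)` and `x² E`.
  rw [upShadow_union, upShadow_mulVar, upShadow_eq_union_mulVar hx C, h.upShadow_eq hx, union_assoc,
    ← mulVar_union,
    ← union_assoc, card_union_of_disjoint (disjoint_mulVar (upShadow_subset_mons hC) _),
    card_mulVar, card_union_of_disjoint (disjoint_mulVar (union_subset hC hU) _), card_mulVar]
  ring

theorem sum_range_card_le_sum (T : Finset ℕ) : ∑ k ∈ range #T, k ≤ ∑ k ∈ T, k := by
  induction T using Finset.induction_on_max with
  | empty => simp
  | insert a s hs ih =>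
    have ha : a ∉ s := fun h => lt_irrefl _ (hs a h)
    rw [card_insert_of_notMem ha, sum_range_succ, sum_insert ha, add_comm]
    refine Nat.add_le_add ?_ ih
    simpa using card_le_card (fun k hk => mem_range.2 (hs k hk) : s ⊆ range a)

/-- Trading `m + 1` for the missing `m` keeps the size and lowers the sum by one. -/
theorem sum_range_card_lt_sum {T : Finset ℕ} {m : ℕ} (h1 : m + 1 ∈ T) (h0 : m ∉ T) :
    ∑ k ∈ range #T, k < ∑ k ∈ T, k := by
  have hm : m ∉ T.erase (m + 1) := fun h => h0 (mem_of_mem_erase h)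
  have h := sum_range_card_le_sum (insert m (T.erase (m + 1)))
  rw [card_insert_of_notMem hm, card_erase_add_one h1, sum_insert hm] at h
  have := add_sum_erase T (fun k => k) h1
  omega

end Monomials

end GotzmannEGF

/-! ### Compression in two variables. -/

namespace GotzmannEGF

open Finset

section Compression

variable {ι : Type*}

/-- The part of a monomial away from the variables `x` and `i`. -/
noncomputable def offPair (x i : ι) (a : ι →₀ ℕ) : ι →₀ ℕ := (a.erase x).erase i

theorem offPair_add_single_left (x i : ι) (a : ι →₀ ℕ) (r : ℕ) :
    offPair x i (a + .single x r) = offPair x i a := by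
  simp [offPair, Finsupp.erase_add]

theorem offPair_congr_add {x i : ι} {a b : ι →₀ ℕ} (h : offPair x i a = offPair x i b)
    (c : ι →₀ ℕ) : offPair x i (a + c) = offPair x i (b + c) := by
  simp only [offPair, Finsupp.erase_add] at h ⊢
  rw [h]

variable [DecidableEq ι]

theorem offPair_add {x i : ι} (hix : i ≠ x) (a : ι →₀ ℕ) :
    offPair x i a + .single x (a x) + .single i (a i) = a := by
  ext j
  simp only [offPair, Finsupp.add_apply, Finsupp.erase_apply, Finsupp.single_apply]
  by_cases h1 : j = i
  · subst h1; simp [hix.symm]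
  · by_cases h2 : j = x
    · subst h2; simp [h1, Ne.symm h1]
    · simp [h1, h2, Ne.symm h1, Ne.symm h2]

theorem offPair_add_single_right (x i : ι) (a : ι →₀ ℕ) (r : ℕ) :
    offPair x i (a + .single i r) = offPair x i a := by
  ext j
  simp only [offPair, Finsupp.add_apply, Finsupp.erase_apply, Finsupp.single_apply]
  grind

/-- The monomials in `A` that agree with `a` away from `x` and `i`. -/
noncomputable def pairFiber (x i : ι) (A : Finset (ι →₀ ℕ)) (a : ι →₀ ℕ) : Finset (ι →₀ ℕ) :=
  A.filter fun b => offPair x i b = offPair x i a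

theorem mem_pairFiber {x i : ι} {A : Finset (ι →₀ ℕ)} {a b : ι →₀ ℕ} :
    b ∈ pairFiber x i A a ↔ b ∈ A ∧ offPair x i b = offPair x i a := by simp [pairFiber]

theorem pairFiber_congr {x i : ι} {A : Finset (ι →₀ ℕ)} {a b : ι →₀ ℕ}
    (h : offPair x i b = offPair x i a) : pairFiber x i A b = pairFiber x i A a := by
  simp [pairFiber, h]

/-- Compression of a set of monomials of degree `d`: on each fibre of `offPair x i` the set is
replaced by the monomials with the smallest exponents of `x`. -/
noncomputable def compress (V : Finset ι) (d : ℕ) (x i : ι) (A : Finset (ι →₀ ℕ)) :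
    Finset (ι →₀ ℕ) :=
  (mons V d).filter fun a => a x < #(pairFiber x i A a)

theorem mem_compress {V : Finset ι} {d : ℕ} {x i : ι} {A : Finset (ι →₀ ℕ)} {a : ι →₀ ℕ} :
    a ∈ compress V d x i A ↔ a ∈ mons V d ∧ a x < #(pairFiber x i A a) := by simp [compress]

theorem eq_of_offPair_eq {V : Finset ι} {d : ℕ} {x i : ι} (hix : i ≠ x) {a b : ι →₀ ℕ}
    (ha : a ∈ mons V d) (hb : b ∈ mons V d) (h : offPair x i a = offPair x i b)
    (hx : a x = b x) : a = b := by
  have hda := (mem_mons.1 ha).1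
  have hdb := (mem_mons.1 hb).1
  rw [← offPair_add hix a] at hda
  rw [← offPair_add hix b] at hdb
  simp only [map_add, Finsupp.degree_single, h, hx] at hda hdb
  rw [← offPair_add hix a, ← offPair_add hix b, h, hx, show a i = b i by omega]

theorem injOn_pairFiber {V : Finset ι} {d : ℕ} {x i : ι} (hix : i ≠ x) {A : Finset (ι →₀ ℕ)}
    (hA : A ⊆ mons V d) (a : ι →₀ ℕ) :
    Set.InjOn (fun b : ι →₀ ℕ => b x) (pairFiber x i A a : Set (ι →₀ ℕ)) := by
  intro b hb c hc h
  rw [mem_coe, mem_pairFiber] at hb hc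
  exact eq_of_offPair_eq hix (hA hb.1) (hA hc.1) (hb.2.trans hc.2.symm) h

/-- In fixed degree a fibre is a chain parametrised by the exponent of `x`; compression turns the
exponents present into an initial interval of the same length. -/
theorem image_pairFiber_compress {V : Finset ι} {d : ℕ} {x i : ι} (hx : x ∈ V) (hi : i ∈ V)
    (hix : i ≠ x) {A : Finset (ι →₀ ℕ)} (hA : A ⊆ mons V d) (a : ι →₀ ℕ) :
    (pairFiber x i (compress V d x i A) a).image (fun b => b x) =
      range #(pairFiber x i A a) := by
  ext r
  simp only [mem_image, mem_range]
  constructor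
  · rintro ⟨b, hb, rfl⟩
    rw [mem_pairFiber, mem_compress] at hb
    rw [← pairFiber_congr hb.2]
    exact hb.1.2
  · intro hr
    obtain ⟨b, hb⟩ := card_pos.1 (lt_of_le_of_lt (Nat.zero_le r) hr)
    rw [mem_pairFiber] at hb
    have hbA := hA hb.1
    -- All members of a fibre share the sum of the exponents of `x` and `i`. This bound makes the
    -- exponent left for `i` in the witness `c` below a genuine difference, not a truncated one.
    have hle : #(pairFiber x i A a) ≤ b x + b i + 1 := by
      rw [← card_image_of_injOn (injOn_pairFiber hix hA a), ← card_range (b x + b i + 1)]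
      refine card_le_card fun s hs => ?_
      obtain ⟨c, hc, rfl⟩ := mem_image.1 hs
      rw [mem_pairFiber] at hc
      have h1 := (mem_mons.1 (hA hc.1)).1
      have h2 := (mem_mons.1 hbA).1
      rw [← offPair_add hix c] at h1
      rw [← offPair_add hix b] at h2
      simp only [map_add, Finsupp.degree_single, hb.2, hc.2] at h1 h2
      rw [mem_range]
      omega
    have hr' : r ≤ b x + b i := by
      have : r < #(pairFiber x i A a) := hr
      omega
    set c : ι →₀ ℕ := offPair x i b + .single x r + .single i (b x + b i - r) with hc
    have hcb : offPair x i c = offPair x i a := by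
      rw [hc, offPair_add_single_right, offPair_add_single_left, ← hb.2]
      nth_rw 2 [← offPair_add hix b]
      rw [offPair_add_single_right, offPair_add_single_left]
    have hcx : c x = r := by
      simp [hc, offPair, hix.symm]
    refine ⟨c, mem_pairFiber.2 ⟨mem_compress.2 ⟨?_, ?_⟩, hcb⟩, hcx⟩
    · rw [mem_mons] at hbA ⊢
      constructor
      · rw [← hbA.1]
        conv_rhs => rw [← offPair_add hix b]
        simp only [hc, map_add, Finsupp.degree_single]
        omega
      · intro j hj
        by_cases hjx : j = x
        · exact hjx ▸ hx
        by_cases hji : j = i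
        · exact hji ▸ hi
        apply hbA.2
        simpa [hc, offPair, Finsupp.erase_apply, hjx, hji, Finsupp.single_apply, Ne.symm hjx,
          Ne.symm hji] using hj
    · rw [pairFiber_congr hcb, hcx]; exact hr

theorem compress_subset (V : Finset ι) (d : ℕ) (x i : ι) (A : Finset (ι →₀ ℕ)) :
    compress V d x i A ⊆ mons V d := filter_subset _ _

theorem card_pairFiber_compress {V : Finset ι} {d : ℕ} {x i : ι} (hx : x ∈ V) (hi : i ∈ V)
    (hix : i ≠ x) {A : Finset (ι →₀ ℕ)} (hA : A ⊆ mons V d) (a : ι →₀ ℕ) :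
    #(pairFiber x i (compress V d x i A) a) = #(pairFiber x i A a) := by
  rw [← card_image_of_injOn (injOn_pairFiber hix (compress_subset V d x i A) a),
    image_pairFiber_compress hx hi hix hA, card_range]

theorem card_compress {V : Finset ι} {d : ℕ} {x i : ι} (hx : x ∈ V) (hi : i ∈ V)
    (hix : i ≠ x) {A : Finset (ι →₀ ℕ)} (hA : A ⊆ mons V d) :
    #(compress V d x i A) = #A := by
  have key : ∀ B ⊆ mons V d, #B = ∑ κ ∈ (mons V d).image (offPair x i),
      #(B.filter fun b => offPair x i b = κ) := fun B hB =>
    card_eq_sum_card_fiberwise fun b hb => mem_image_of_mem _ (hB hb)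
  rw [key _ (compress_subset V d x i A), key _ hA]
  refine sum_congr rfl fun κ hκ => ?_
  obtain ⟨a, -, rfl⟩ := mem_image.1 hκ
  exact card_pairFiber_compress hx hi hix hA a

theorem sum_pairFiber {V : Finset ι} {d : ℕ} {x i : ι} (hix : i ≠ x) {A : Finset (ι →₀ ℕ)}
    (hA : A ⊆ mons V d) (a : ι →₀ ℕ) :
    ∑ b ∈ pairFiber x i A a, b x = ∑ k ∈ (pairFiber x i A a).image (fun b => b x), k :=
  (sum_image (f := fun k => k) (injOn_pairFiber hix hA a)).symm

/-- A failure of stability is a gap in a fibre: the exponent `b x + 1` of `x` occurs and `b x` does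
not. Closing it strictly lowers the sum, which makes repeated compression terminate. -/
theorem sum_compress_lt {V : Finset ι} {d : ℕ} {x i : ι} (hx : x ∈ V) (hi : i ∈ V)
    (hix : i ≠ x) {A : Finset (ι →₀ ℕ)} (hA : A ⊆ mons V d) {b : ι →₀ ℕ}
    (hb : b + .single x 1 ∈ A) (hbi : b + .single i 1 ∉ A) :
    ∑ a ∈ compress V d x i A, a x < ∑ a ∈ A, a x := by
  have key : ∀ B ⊆ mons V d, ∑ a ∈ B, a x = ∑ κ ∈ (mons V d).image (offPair x i),
      ∑ a ∈ B.filter fun b => offPair x i b = κ, a x := fun B hB =>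
    (sum_fiberwise_of_maps_to (fun b hb => mem_image_of_mem _ (hB hb)) _).symm
  have hC := compress_subset V d x i A
  rw [key _ hC, key _ hA]
  refine sum_lt_sum (fun κ hκ => ?_) ⟨offPair x i (b + .single x 1), mem_image_of_mem _ (hA hb), ?_⟩
  · obtain ⟨a, -, rfl⟩ := mem_image.1 hκ
    change ∑ c ∈ pairFiber x i _ a, c x ≤ ∑ c ∈ pairFiber x i _ a, c x
    rw [sum_pairFiber hix hC, sum_pairFiber hix hA, image_pairFiber_compress hx hi hix hA,
      ← card_image_of_injOn (injOn_pairFiber hix hA a)]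
    exact sum_range_card_le_sum _
  · set a := b + .single x 1 with ha
    change ∑ c ∈ pairFiber x i _ a, c x < ∑ c ∈ pairFiber x i _ a, c x
    rw [sum_pairFiber hix hC, sum_pairFiber hix hA, image_pairFiber_compress hx hi hix hA,
      ← card_image_of_injOn (injOn_pairFiber hix hA a)]
    refine sum_range_card_lt_sum (m := b x) ?_ ?_
    · exact mem_image.2 ⟨a, mem_filter.2 ⟨hb, rfl⟩, by simp [ha]⟩
    · intro h
      obtain ⟨c, hc, hcx⟩ := mem_image.1 h
      rw [mem_pairFiber] at hc
      have hab : b + .single i 1 ∈ mons V d := by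
        cases d with
        | zero =>
          have := hA hb
          rw [mons_zero, mem_singleton] at this
          simpa [ha] using congrArg Finsupp.degree this
        | succ d => rw [add_single_mem_mons hi, ← add_single_mem_mons hx]; exact hA hb
      have : c = b + .single i 1 := by
        refine eq_of_offPair_eq hix (hA hc.1) hab ?_ ?_
        · rw [hc.2, ha, offPair_add_single_left, offPair_add_single_right]
        · simp [hcx, hix]
      exact hbi (this ▸ hc.1)

/-- The shadow of the compression lies in the compression of the shadow, and the latter has the size
of the original shadow. The claim is checked on fibres: multiplying by `j ≠ x` keeps the exponent of
`x` and does not shrink the fibre, while multiplying by `x` needs one additional element. -/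
theorem card_upShadow_compress_le {V : Finset ι} {d : ℕ} {x i : ι} (hx : x ∈ V) (hi : i ∈ V)
    (hix : i ≠ x) {A : Finset (ι →₀ ℕ)} (hA : A ⊆ mons V d) :
    #(upShadow V (compress V d x i A)) ≤ #(upShadow V A) := by
  rw [← card_compress hx hi hix (upShadow_subset_mons hA)]
  refine card_le_card fun c hc => ?_
  obtain ⟨a, ha, j, hj, rfl⟩ := mem_upShadow.1 hc
  rw [mem_compress] at ha ⊢
  refine ⟨(add_single_mem_mons hj).2 ha.1, ?_⟩
  have hmap : ∀ b ∈ pairFiber x i A a, b + .single j 1 ∈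
      pairFiber x i (upShadow V A) (a + .single j 1) := by
    intro b hb
    rw [mem_pairFiber] at hb ⊢
    exact ⟨add_single_mem_upShadow hb.1 hj, offPair_congr_add hb.2 _⟩
  have hsub : (pairFiber x i A a).image (fun b => b + .single j 1) ⊆
      pairFiber x i (upShadow V A) (a + .single j 1) := by
    intro c hc
    obtain ⟨b, hb, rfl⟩ := mem_image.1 hc
    exact hmap b hb
  have hcard : #((pairFiber x i A a).image (fun b => b + .single j 1)) = #(pairFiber x i A a) :=
    card_image_of_injective _ (add_left_injective _)
  by_cases hjx : j = x
  · subst hjx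
    have hne : (pairFiber j i A a).Nonempty :=
      card_pos.1 (lt_of_le_of_lt (Nat.zero_le _) ha.2)
    -- The additional element is `b * i` with `b` of largest exponent in `i`: that exponent exceeds
    -- the one of every product of the fibre with `x`.
    obtain ⟨b, hb, hmax⟩ := exists_max_image _ (fun b => b i) hne
    have hnew : b + .single i 1 ∉ (pairFiber j i A a).image (fun b => b + .single j 1) := by
      intro h
      obtain ⟨c, hc, hcb⟩ := mem_image.1 h
      have h1 := hmax c hc
      have h2 := DFunLike.congr_fun hcb i
      simp [hix.symm] at h2
      omega
    have hsub' : insert (b + .single i 1) ((pairFiber j i A a).image (fun b => b + .single j 1)) ⊆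
        pairFiber j i (upShadow V A) (a + .single j 1) := by
      refine insert_subset ?_ hsub
      rw [mem_pairFiber] at hb ⊢
      refine ⟨add_single_mem_upShadow hb.1 hi, ?_⟩
      rw [offPair_add_single_left, offPair_add_single_right, hb.2]
    have := card_le_card hsub'
    rw [card_insert_of_notMem hnew, hcard] at this
    have h2 := ha.2
    simp only [Finsupp.add_apply, Finsupp.single_eq_same]
    omega
  · have := card_le_card hsub
    rw [hcard] at this
    have h2 := ha.2
    simp only [Finsupp.add_apply, Finsupp.single_apply, hjx, if_false]
    omega

theorem exists_isStable {V : Finset ι} {d : ℕ} {x : ι} (hx : x ∈ V) {A : Finset (ι →₀ ℕ)}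
    (hA : A ⊆ mons V d) :
    ∃ B ⊆ mons V d, #B = #A ∧ #(upShadow V B) ≤ #(upShadow V A) ∧ IsStable V x B := by
  induction hs : ∑ a ∈ A, a x using Nat.strong_induction_on generalizing A with
  | _ s ih =>
    by_cases h : IsStable V x A
    · exact ⟨A, hA, rfl, le_rfl, h⟩
    · simp only [IsStable, not_forall] at h
      obtain ⟨b, hb, i, hi, hbi⟩ := h
      have hix : i ≠ x := by rintro rfl; exact hbi hb
      obtain ⟨B, hB, hc, hu, hst⟩ := ih _ (hs ▸ sum_compress_lt hx hi hix hA hb hbi)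
        (compress_subset V d x i A) rfl
      exact ⟨B, hB, hc.trans (card_compress hx hi hix hA),
        hu.trans (card_upShadow_compress_le hx hi hix hA), hst⟩

end Compression

/-! ### Green's and Macaulay's bounds. -/

section Macaulay

variable {ι : Type*} [DecidableEq ι]

/-- The exponents `b` with `x b ∈ A`. -/
noncomputable def divVar (x : ι) (A : Finset (ι →₀ ℕ)) : Finset (ι →₀ ℕ) :=
  (A.filter fun a => a x ≠ 0).image fun a => a - .single x 1

theorem mem_divVar {x : ι} {A : Finset (ι →₀ ℕ)} {b : ι →₀ ℕ} :
    b ∈ divVar x A ↔ b + .single x 1 ∈ A := by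
  simp only [divVar, mem_image, mem_filter]
  constructor
  · rintro ⟨a, ⟨ha, hax⟩, rfl⟩
    obtain ⟨b, rfl⟩ := exists_eq_add_single hax
    simpa using ha
  · intro h
    exact ⟨_, ⟨h, by simp⟩, by simp⟩

theorem without_union_mulVar_divVar (x : ι) (A : Finset (ι →₀ ℕ)) :
    without x A ∪ mulVar x (divVar x A) = A := by
  ext a
  rw [mem_union, mem_without]
  constructor
  · rintro (h | h)
    · exact h.1
    · obtain ⟨b, hb, rfl⟩ := mem_mulVar.1 h
      exact mem_divVar.1 hb
  · intro h
    by_cases hax : a x = 0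
    · exact .inl ⟨h, hax⟩
    · obtain ⟨b, rfl⟩ := exists_eq_add_single hax
      exact .inr (add_single_mem_mulVar.2 (mem_divVar.2 h))

theorem card_eq_without_add_divVar (x : ι) (A : Finset (ι →₀ ℕ)) :
    #A = #(without x A) + #(divVar x A) := by
  conv_lhs => rw [← without_union_mulVar_divVar x A]
  rw [card_union_of_disjoint, card_mulVar]
  rw [disjoint_left]
  exact fun a ha hb => ne_zero_of_mem_mulVar hb (mem_without.1 ha).2

theorem divVar_subset_mons {V : Finset ι} {d : ℕ} {x : ι} (hx : x ∈ V) {A : Finset (ι →₀ ℕ)}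
    (hA : A ⊆ mons V (d + 1)) : divVar x A ⊆ mons V d := fun _ hb =>
  (add_single_mem_mons hx).1 (hA (mem_divVar.1 hb))

theorem IsStable.divVar {V : Finset ι} {x : ι} {A : Finset (ι →₀ ℕ)} (h : IsStable V x A) :
    IsStable V x (divVar x A) := by
  intro b hb i hi
  rw [mem_divVar] at hb ⊢
  rw [add_right_comm]
  exact h _ hb i hi

/-- If `a * x ∈ A`, stability puts `a * i` in `A`. This bounds the `x`-free part of `A` from below
by a shadow one degree lower. -/
theorem IsStable.upShadow_divVar_subset {V : Finset ι} {x : ι} {A : Finset (ι →₀ ℕ)}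
    (h : IsStable V x A) :
    upShadow (V.erase x) (without x (GotzmannEGF.divVar x A)) ⊆ without x A := by
  intro c hc
  obtain ⟨a, ha, i, hi, rfl⟩ := mem_upShadow.1 hc
  rw [mem_without, mem_divVar] at ha
  rw [mem_erase] at hi
  exact mem_without.2 ⟨h _ ha.1 i hi.2, by simp [ha.2, hi.1]⟩

/-- Green's hyperplane restriction bound for stable sets. -/
theorem IsStable.lexRestrict_le_card {V : Finset ι} {x : ι} (hx : x ∈ V)
    (hM : ∀ d, ∀ A ⊆ mons (V.erase x) d,
      lexGrowth #(V.erase x) d #A ≤ #(upShadow (V.erase x) A))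
    {d : ℕ} {A : Finset (ι →₀ ℕ)} (hA : A ⊆ mons V d) (h : IsStable V x A) :
    lexRestrict #(V.erase x) d #A ≤ #(without x A) := by
  have hcV : #V = #(V.erase x) + 1 := by rw [card_erase_add_one hx]
  induction d generalizing A with
  | zero =>
    rw [lexRestrict_deg_zero]
    have : without x A = A := by
      rw [without, filter_eq_self]
      intro a ha
      have := hA ha
      rw [mons_zero, mem_singleton] at this
      simp [this]
    rw [this]
    exact min_le_left _ _
  | succ d ih =>
    -- Too small an `x`-free part leaves a large quotient by `x`. Induction on the degree bounds the
    -- `x`-free part of the quotient, whose shadow lies in the `x`-free part of `A` and is too big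
    -- by Macaulay in fewer variables and `lexRestrict_le_lexGrowth`.
    by_contra hlt
    rw [not_le] at hlt
    have hD := divVar_subset_mons hx hA
    have hcard := card_eq_without_add_divVar x A
    have hDle := card_le_multichoose hD
    have hAle := card_le_multichoose hA
    rw [hcV] at hDle hAle
    have hle := lexRestrict_le_self #(V.erase x) (d + 1) #A
    have h1 := lexRestrict_le_lexGrowth #(V.erase x) d #A hAle (by omega)
    have h2 := ih hD h.divVar
    have h3 := hM d _ (without_subset_mons hD)
    have h4 := card_le_card h.upShadow_divVar_subset
    have h5 := lexGrowth_mono #(V.erase x) d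
      ((lexRestrict_mono #(V.erase x) d (show #A - lexRestrict #(V.erase x) (d + 1) #A + 1 ≤
        #(GotzmannEGF.divVar x A) by omega)).trans h2)
    omega

/-- Macaulay's theorem: lexicographic segments have the smallest upper shadows. -/
theorem lexGrowth_le_card_upShadow (V : Finset ι) (d : ℕ) (A : Finset (ι →₀ ℕ))
    (hA : A ⊆ mons V d) : lexGrowth #V d #A ≤ #(upShadow V A) := by
  induction hn : #V generalizing V d A with
  | zero => rw [lexGrowth_zero_vars]; exact Nat.zero_le _
  | succ n ih =>
    obtain ⟨x, hx⟩ := card_pos.1 (by omega : 0 < #V)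
    have hcV : #(V.erase x) = n := by rw [card_erase_of_mem hx]; omega
    obtain ⟨B, hB, hBc, hBu, hBs⟩ := exists_isStable hx hA
    have hM : ∀ d, ∀ A ⊆ mons (V.erase x) d,
        lexGrowth #(V.erase x) d #A ≤ #(upShadow (V.erase x) A) := by
      intro d A hA
      rw [hcV]
      exact ih _ d A hA hcV
    have hG := hBs.lexRestrict_le_card hx hM hB
    have hle := card_le_multichoose hB
    rw [hn] at hle
    -- The two sides now decompose alike, as `#B` plus a growth in the remaining variables; Green's
    -- bound and the induction hypothesis compare the second summands.
    rw [← hBc, lexGrowth_eq_add_lexRestrict n d _ hle]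
    refine le_trans ?_ hBu
    rw [hBs.card_upShadow hx hB]
    refine Nat.add_le_add_left ?_ _
    rw [hcV] at hG hM
    exact (lexGrowth_mono n d hG).trans (hM d _ (without_subset_mons hB))

end Macaulay

end GotzmannEGF

/-! ### Lexicographic segments and the sharpness of Macaulay's bound. -/

namespace GotzmannEGF

open Finset

section LexSegments

variable {ι : Type*}

/-- Induction along the recursion defining `lexSegList`. -/
theorem list_deg_rec {P : List ι → ℕ → Prop} (h0 : ∀ l, P l 0) (h1 : ∀ d, P [] (d + 1))
    (h2 : ∀ x l d, x ∉ l → P (x :: l) d → P l (d + 1) → P (x :: l) (d + 1))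
    (l : List ι) (hl : l.Nodup) (d : ℕ) : P l d := by
  induction l generalizing d with
  | nil => cases d with
    | zero => exact h0 []
    | succ d => exact h1 d
  | cons x l ihl =>
    rw [List.nodup_cons] at hl
    induction d with
    | zero => exact h0 _
    | succ d ihd => exact h2 x l d hl.1 ihd (ihl hl.2 _)

variable [DecidableEq ι]

/-- The lexicographic segment of `a` monomials of degree `d` in the variables of a list. -/
noncomputable def lexSegList : List ι → ℕ → ℕ → Finset (ι →₀ ℕ)
  | _, 0, a => if a = 0 then ∅ else {0}
  | [], _ + 1, _ => ∅
  | x :: l, d + 1, a =>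
    mulVar x (lexSegList (x :: l) d (min a (Nat.multichoose (l.length + 1) d))) ∪
      lexSegList l (d + 1) (a - Nat.multichoose (l.length + 1) d)

theorem lexSegList_deg_zero (l : List ι) (a : ℕ) :
    lexSegList l 0 a = if a = 0 then ∅ else {0} := by
  cases l <;> simp [lexSegList]

theorem lexSegList_cons_succ (x : ι) (l : List ι) (d a : ℕ) : lexSegList (x :: l) (d + 1) a =
    mulVar x (lexSegList (x :: l) d (min a (Nat.multichoose (l.length + 1) d))) ∪
      lexSegList l (d + 1) (a - Nat.multichoose (l.length + 1) d) := by
  simp [lexSegList]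

@[simp] theorem mulVar_empty (x : ι) : mulVar x ∅ = ∅ := by simp [mulVar]

theorem lexSegList_zero (l : List ι) (hl : l.Nodup) (d : ℕ) : lexSegList l d 0 = ∅ := by
  refine list_deg_rec (P := fun l d => lexSegList l d 0 = ∅) ?_ ?_ ?_ l hl d
  · intro l; simp [lexSegList_deg_zero]
  · intro d; simp [lexSegList]
  · intro x l d _ h1 h2; simp [lexSegList_cons_succ, h1, h2]

theorem lexSegList_subset (l : List ι) (hl : l.Nodup) (d : ℕ) :
    ∀ a, lexSegList l d a ⊆ mons l.toFinset d := by
  refine list_deg_rec (P := fun l d => ∀ a, lexSegList l d a ⊆ mons l.toFinset d) ?_ ?_ ?_ l hl d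
  · intro l a; rw [lexSegList_deg_zero]; split_ifs <;> simp
  · intro d a; simp [lexSegList]
  · intro x l d _ h1 h2 a
    rw [lexSegList_cons_succ]
    refine union_subset (mulVar_subset_mons (by simp) (h1 _)) ((h2 _).trans ?_)
    exact finsuppAntidiag_mono (by simp) _

theorem toFinset_cons_erase {x : ι} {l : List ι} (hx : x ∉ l) :
    (x :: l).toFinset.erase x = l.toFinset := by
  rw [List.toFinset_cons, erase_insert (by simpa using hx)]

theorem card_lexSegList (l : List ι) (hl : l.Nodup) (d : ℕ) :
    ∀ a ≤ Nat.multichoose l.length d, #(lexSegList l d a) = a := by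
  have key : ∀ a ≤ Nat.multichoose l.length d,
      #(lexSegList l d a) = a ∧ lexSegList l d a ⊆ mons l.toFinset d := by
    refine list_deg_rec (P := fun l d => ∀ a ≤ Nat.multichoose l.length d,
      #(lexSegList l d a) = a ∧ lexSegList l d a ⊆ mons l.toFinset d) ?_ ?_ ?_ l hl d
    · intro l a ha
      rw [Nat.multichoose_zero_right] at ha
      interval_cases a <;> simp [lexSegList_deg_zero]
    · intro d a ha
      rw [List.length_nil, Nat.multichoose_zero_succ] at ha
      simp [lexSegList, Nat.le_zero.1 ha]
    · intro x l d hx h1 h2 a ha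
      rw [List.length_cons] at h1 ha
      rw [multichoose_succ_succ'] at ha
      have h3 := h1 (min a (Nat.multichoose (l.length + 1) d)) (min_le_right _ _)
      have h4 := h2 (a - Nat.multichoose (l.length + 1) d) (by omega)
      rw [lexSegList_cons_succ]
      constructor
      · rw [card_union_of_disjoint, card_mulVar, h3.1, h4.1]
        · omega
        · rw [← toFinset_cons_erase hx] at h4
          exact (disjoint_mulVar h4.2 _).symm
      · refine union_subset (mulVar_subset_mons (by simp) h3.2) (h4.2.trans ?_)
        exact finsuppAntidiag_mono (by simp) _
  exact fun a ha => (key a ha).1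

theorem lexSegList_mono (l : List ι) (hl : l.Nodup) (d : ℕ) : Monotone (lexSegList l d) := by
  refine list_deg_rec (P := fun l d => Monotone (lexSegList l d)) ?_ ?_ ?_ l hl d
  · intro l a b hab
    simp only [lexSegList_deg_zero]
    split_ifs
    · exact subset_rfl
    · exact empty_subset _
    · omega
    · exact subset_rfl
  · intro d a b _; simp [lexSegList]
  · intro x l d _ h1 h2 a b hab
    simp only [lexSegList_cons_succ]
    exact union_subset_union (mulVar_mono (h1 (by omega))) (h2 (by omega))

theorem lexSegList_full (l : List ι) (hl : l.Nodup) (d : ℕ) :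
    lexSegList l d (Nat.multichoose l.length d) = mons l.toFinset d := by
  refine eq_of_subset_of_card_le (lexSegList_subset l hl d _) ?_
  rw [card_mons, card_lexSegList l hl d _ le_rfl, List.toFinset_card_of_nodup hl]

/-- Sharpness: the shadow is again a segment, not merely a set of the right size. The rearrangements
of layers below need this so that consecutive segments are nested. -/
theorem upShadow_lexSegList (l : List ι) (hl : l.Nodup) (d : ℕ) :
    ∀ a ≤ Nat.multichoose l.length d, upShadow l.toFinset (lexSegList l d a) =
      lexSegList l (d + 1) (lexGrowth l.length d a) := by
  induction l generalizing d with
  | nil =>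
    intro a _
    cases d <;> simp [lexSegList, upShadow]
  | cons x l ihl =>
    have hl' := List.nodup_cons.1 hl
    induction d with
    | zero =>
      intro a ha
      rw [Nat.multichoose_zero_right] at ha
      have h := lexSegList_full (x :: l) hl 0
      have h' := lexSegList_full (x :: l) hl 1
      rw [Nat.multichoose_zero_right] at h
      rw [Nat.multichoose_one_right] at h'
      interval_cases a
      · simp [lexGrowth_deg_zero, lexSegList_zero _ hl]
      · rw [lexGrowth_deg_zero, if_neg one_ne_zero, h, upShadow_mons, h']
    | succ d ihd =>
      intro a ha
      rw [List.length_cons] at ha ihd ⊢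
      rw [multichoose_succ_succ'] at ha
      rcases le_or_gt a (Nat.multichoose (l.length + 1) d) with h | h
      · rw [lexGrowth_succ_deg h, lexSegList_cons_succ, lexSegList_cons_succ, min_eq_left h,
          Nat.sub_eq_zero_of_le h, min_eq_left (lexGrowth_le _ _ _),
          Nat.sub_eq_zero_of_le (lexGrowth_le _ _ _), lexSegList_zero _ hl'.2,
          lexSegList_zero _ hl'.2, union_empty, union_empty, upShadow_mulVar, ihd a h]
      -- The segment contains all multiples of `x`, hence so does its shadow; beyond these only the
      -- growth of the `x`-free remainder counts.
      · obtain ⟨b, rfl⟩ := Nat.exists_eq_add_of_le h.le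
        have hfull : ∀ e, lexSegList (x :: l) e (Nat.multichoose (l.length + 1) e) =
          mons (x :: l).toFinset e := lexSegList_full (x :: l) hl
        rw [lexGrowth_add, lexSegList_cons_succ, lexSegList_cons_succ,
          min_eq_right (Nat.le_add_right _ _), min_eq_right (Nat.le_add_right _ _),
          Nat.add_sub_cancel_left, Nat.add_sub_cancel_left, hfull, hfull, upShadow_union,
          upShadow_mulVar, upShadow_mons,
          upShadow_eq_union_mulVar (by simp : x ∈ (x :: l).toFinset) (lexSegList l (d + 1) b),
          toFinset_cons_erase hl'.1, ihl hl'.2 (d + 1) b (by omega), union_comm _ (mulVar x _),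
          ← union_assoc, ← mulVar_union]
        congr 2
        rw [union_eq_left]
        exact (lexSegList_subset l hl'.2 _ _).trans (finsuppAntidiag_mono (by simp) _)

/-- The lexicographic segment of `a` monomials of degree `d` in the variables of `V`. -/
noncomputable def lexSeg (V : Finset ι) (d a : ℕ) : Finset (ι →₀ ℕ) := lexSegList V.toList d a

theorem lexSeg_subset (V : Finset ι) (d a : ℕ) : lexSeg V d a ⊆ mons V d := by
  simpa [lexSeg] using lexSegList_subset V.toList V.nodup_toList d a

theorem card_lexSeg {V : Finset ι} {d a : ℕ} (h : a ≤ Nat.multichoose #V d) :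
    #(lexSeg V d a) = a :=
  card_lexSegList V.toList V.nodup_toList d a (by simpa using h)

theorem lexSeg_mono (V : Finset ι) (d : ℕ) : Monotone (lexSeg V d) :=
  lexSegList_mono V.toList V.nodup_toList d

theorem upShadow_lexSeg {V : Finset ι} {d a : ℕ} (h : a ≤ Nat.multichoose #V d) :
    upShadow V (lexSeg V d a) = lexSeg V (d + 1) (lexGrowth #V d a) := by
  simpa [lexSeg] using upShadow_lexSegList V.toList V.nodup_toList d a (by simpa using h)

theorem card_upShadow_lexSeg {V : Finset ι} {d a : ℕ} (h : a ≤ Nat.multichoose #V d) :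
    #(upShadow V (lexSeg V d a)) = lexGrowth #V d a := by
  rw [upShadow_lexSeg h, card_lexSeg (lexGrowth_le _ _ _)]

end LexSegments

end GotzmannEGF

/-! ### Squarefree ideals: restriction to fewer variables and colon by a variable. -/

namespace GotzmannEGF

open Finset

section SquarefreeSets

variable {ι : Type*} [DecidableEq ι]

open Classical in
/-- The monomials of degree `d` in the variables in `V` whose support lies in `U`. -/
noncomputable def monsIn (V : Finset ι) (U : Set (Finset ι)) (d : ℕ) : Finset (ι →₀ ℕ) :=
  (mons V d).filter fun a => a.support ∈ U

theorem mem_monsIn {V : Finset ι} {U : Set (Finset ι)} {d : ℕ} {a : ι →₀ ℕ} :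
    a ∈ monsIn V U d ↔ a ∈ mons V d ∧ a.support ∈ U := by simp [monsIn]

theorem monsIn_subset (V : Finset ι) (U : Set (Finset ι)) (d : ℕ) : monsIn V U d ⊆ mons V d :=
  fun _ ha => (mem_monsIn.1 ha).1

/-- The combinatorial form of the Gotzmann property for the squarefree ideal of the polynomial
ring in the variables in `V` spanned by the monomials with support in `U`. -/
def GotzmannOn (V : Finset ι) (U : Set (Finset ι)) : Prop :=
  ∀ d, #(upShadow V (monsIn V U d)) ≤ lexGrowth #V d #(monsIn V U d)

/-- The colon by the variable `x`. -/
def link (x : ι) (U : Set (Finset ι)) : Set (Finset ι) := {s | insert x s ∈ U}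

theorem mem_link {x : ι} {U : Set (Finset ι)} {s : Finset ι} :
    s ∈ link x U ↔ insert x s ∈ U := Iff.rfl

theorem isUpperSet_link {U : Set (Finset ι)} (hU : IsUpperSet U) (x : ι) :
    IsUpperSet (link x U) :=
  fun _ _ hst hs => hU (insert_subset_insert x hst) hs

theorem support_add_single (a : ι →₀ ℕ) (x : ι) :
    (a + .single x 1).support = insert x a.support := by
  ext j
  simp only [Finsupp.mem_support_iff, Finsupp.add_apply, mem_insert, Finsupp.single_apply]
  split_ifs with h
  · simp [h]
  · simp [Ne.symm h]

theorem add_single_mem_monsIn {V : Finset ι} {U : Set (Finset ι)} {d : ℕ} {x : ι} (hx : x ∈ V)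
    {a : ι →₀ ℕ} : a + .single x 1 ∈ monsIn V U (d + 1) ↔ a ∈ monsIn V (link x U) d := by
  rw [mem_monsIn, mem_monsIn, add_single_mem_mons hx, support_add_single, mem_link]

theorem without_monsIn (V : Finset ι) (U : Set (Finset ι)) (d : ℕ) (x : ι) :
    without x (monsIn V U d) = monsIn (V.erase x) U d := by
  ext a
  rw [mem_without, mem_monsIn, mem_monsIn, mem_mons_erase]
  tauto

theorem divVar_monsIn {V : Finset ι} {x : ι} (hx : x ∈ V) (U : Set (Finset ι)) (d : ℕ) :
    divVar x (monsIn V U (d + 1)) = monsIn V (link x U) d := by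
  ext a
  rw [mem_divVar, add_single_mem_monsIn hx]

theorem monsIn_succ {V : Finset ι} {x : ι} (hx : x ∈ V) (U : Set (Finset ι)) (d : ℕ) :
    monsIn V U (d + 1) =
      monsIn (V.erase x) U (d + 1) ∪ mulVar x (monsIn V (link x U) d) := by
  rw [← divVar_monsIn hx, ← without_monsIn, without_union_mulVar_divVar]

theorem card_monsIn_succ {V : Finset ι} {x : ι} (hx : x ∈ V) (U : Set (Finset ι)) (d : ℕ) :
    #(monsIn V U (d + 1)) = #(monsIn (V.erase x) U (d + 1)) + #(monsIn V (link x U) d) := by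
  rw [← divVar_monsIn hx, ← without_monsIn, ← card_eq_without_add_divVar]

theorem link_link (x : ι) (U : Set (Finset ι)) : link x (link x U) = link x U := by
  ext s; simp [mem_link]

/-- For a squarefree ideal the colons by `x` and by `x²` agree, so the factor `x` of a member of the
colon can be dropped and any other variable put in its place. -/
theorem isStable_monsIn_link {U : Set (Finset ι)} (hU : IsUpperSet U) (V : Finset ι) {x : ι}
    (hx : x ∈ V) (d : ℕ) : IsStable V x (monsIn V (link x U) d) := by
  intro b hb i hi
  cases d with
  | zero =>
    have := monsIn_subset _ _ _ hb
    rw [mons_zero, mem_singleton] at this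
    simpa using congrArg Finsupp.degree this
  | succ d =>
    rw [add_single_mem_monsIn hx, link_link] at hb
    rw [add_single_mem_monsIn hi]
    rw [mem_monsIn] at hb ⊢
    exact ⟨hb.1, hU (insert_subset_insert _ (subset_insert _ _)) hb.2⟩

theorem card_upShadow_monsIn {U : Set (Finset ι)} (hU : IsUpperSet U) {V : Finset ι} {x : ι}
    (hx : x ∈ V) (d : ℕ) : #(upShadow V (monsIn V U (d + 1))) =
      #(upShadow (V.erase x) (monsIn (V.erase x) U (d + 1))) +
      #(monsIn (V.erase x) U (d + 1) ∪ upShadow (V.erase x) (monsIn (V.erase x) (link x U) d)) +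
      #(monsIn V (link x U) d) := by
  rw [monsIn_succ hx, IsStable.card_upShadow_union_mulVar hx (monsIn_subset _ _ _)
    (monsIn_subset _ _ _) (isStable_monsIn_link hU V hx d), without_monsIn]

theorem upShadow_monsIn_subset {U : Set (Finset ι)} (hU : IsUpperSet U) (V : Finset ι) (d : ℕ) :
    upShadow V (monsIn V U d) ⊆ monsIn V U (d + 1) := by
  intro c hc
  obtain ⟨a, ha, i, hi, rfl⟩ := mem_upShadow.1 hc
  rw [add_single_mem_monsIn hi]
  rw [mem_monsIn] at ha ⊢
  exact ⟨ha.1, hU (subset_insert _ _) ha.2⟩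

theorem lexGrowth_card_monsIn_le {U : Set (Finset ι)} (hU : IsUpperSet U) (V : Finset ι) (d : ℕ) :
    lexGrowth #V d #(monsIn V U d) ≤ #(monsIn V U (d + 1)) :=
  (lexGrowth_le_card_upShadow V d _ (monsIn_subset _ _ _)).trans
    (card_le_card (upShadow_monsIn_subset hU V d))

theorem without_eq_self {V : Finset ι} {d : ℕ} {x : ι} {A : Finset (ι →₀ ℕ)}
    (h : A ⊆ mons (V.erase x) d) : without x A = A :=
  filter_eq_self.2 fun _ ha => (mem_mons_erase.1 (h ha)).2

theorem without_mulVar (x : ι) (A : Finset (ι →₀ ℕ)) : without x (mulVar x A) = ∅ :=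
  filter_eq_empty_iff.2 fun _ ha => ne_zero_of_mem_mulVar ha

/-- A stable set with the same sizes as the layers of a colon ideal, and with a lexicographic
segment as its part without `x`. -/
theorem exists_isStable_lexSeg {U : Set (Finset ι)} (hU : IsUpperSet U) {V : Finset ι} {x : ι}
    (hx : x ∈ V) (d : ℕ) : ∃ E ⊆ mons V d, IsStable V x E ∧ #E = #(monsIn V (link x U) d) ∧
      without x E = lexSeg (V.erase x) d #(monsIn (V.erase x) (link x U) d) := by
  have hle : ∀ d, #(monsIn (V.erase x) (link x U) d) ≤ Nat.multichoose #(V.erase x) d :=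
    fun d => card_le_multichoose (monsIn_subset _ _ _)
  have hsub : ∀ d a, lexSeg (V.erase x) d a ⊆ mons V d := fun d a =>
    (lexSeg_subset _ _ _).trans (finsuppAntidiag_mono (erase_subset _ _) _)
  induction d with
  | zero =>
    refine ⟨lexSeg (V.erase x) 0 #(monsIn (V.erase x) (link x U) 0), hsub _ _, ?_, ?_,
      without_eq_self (lexSeg_subset _ _ _)⟩
    · intro b hb
      have := lexSeg_subset _ _ _ hb
      rw [mons_zero, mem_singleton] at this
      simpa using congrArg Finsupp.degree this
    · rw [card_lexSeg (hle 0)]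
      congr 1
      ext a
      simp [mem_monsIn]
  | succ d ih =>
    obtain ⟨E, hE, hst, hc, hw⟩ := ih
    set C := lexSeg (V.erase x) (d + 1) #(monsIn (V.erase x) (link x U) (d + 1)) with hC
    have hCs : C ⊆ mons (V.erase x) (d + 1) := lexSeg_subset _ _ _
    -- Stability of the next layer rests on this inclusion: both sides are segments, and Macaulay
    -- applied to the colon orders their sizes.
    have hup : upShadow (V.erase x) (without x E) ⊆ C := by
      rw [hw, upShadow_lexSeg (hle d)]
      exact lexSeg_mono _ _ (lexGrowth_card_monsIn_le (isUpperSet_link hU x) _ _)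
    refine ⟨C ∪ mulVar x E, union_subset (hsub _ _) (mulVar_subset_mons hx hE), ?_, ?_, ?_⟩
    · intro b hb i hi
      have hbE : b ∈ E := by
        rcases mem_union.1 hb with h | h
        · have := (mem_mons_erase.1 (hCs h)).2
          simp at this
        · exact add_single_mem_mulVar.1 h
      by_cases hix : i = x
      · exact hix ▸ hb
      · by_cases hbx : b x = 0
        · exact mem_union_left _ (hup (add_single_mem_upShadow (mem_without.2 ⟨hbE, hbx⟩)
            (mem_erase.2 ⟨hix, hi⟩)))
        · obtain ⟨c, rfl⟩ := exists_eq_add_single hbx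
          rw [add_right_comm]
          exact mem_union_right _ (add_single_mem_mulVar.2 (hst c hbE i hi))
    · rw [card_union_of_disjoint (disjoint_mulVar hCs _), card_mulVar, hc, card_lexSeg (hle _),
        card_monsIn_succ hx (link x U) d, link_link]
    · rw [without, filter_union, ← without, ← without, without_mulVar, without_eq_self hCs,
        union_empty]

/-- The main estimate: the growth of a Gotzmann ideal is bounded in terms of its restriction and
its colon by a variable. -/
theorem GotzmannOn.card_add_card_le {V : Finset ι} {U : Set (Finset ι)} (h : GotzmannOn V U)
    (hU : IsUpperSet U) {x : ι} (hx : x ∈ V) (d : ℕ) :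
    #(upShadow (V.erase x) (monsIn (V.erase x) U (d + 1))) +
      #(monsIn (V.erase x) U (d + 1) ∪ upShadow (V.erase x) (monsIn (V.erase x) (link x U) d)) ≤
    lexGrowth #(V.erase x) (d + 1) #(monsIn (V.erase x) U (d + 1)) +
      max #(monsIn (V.erase x) U (d + 1))
        (lexGrowth #(V.erase x) d #(monsIn (V.erase x) (link x U) d)) := by
  obtain ⟨E, hE, hst, hc, hw⟩ := exists_isStable_lexSeg hU hx d
  set p := #(monsIn (V.erase x) U (d + 1)) with hp
  set q := #(monsIn (V.erase x) (link x U) d) with hq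
  have hple : p ≤ Nat.multichoose #(V.erase x) (d + 1) :=
    card_le_multichoose (monsIn_subset _ _ _)
  have hqle : q ≤ Nat.multichoose #(V.erase x) d := card_le_multichoose (monsIn_subset _ _ _)
  set C := lexSeg (V.erase x) (d + 1) p with hC
  have hCs : C ⊆ mons (V.erase x) (d + 1) := lexSeg_subset _ _ _
  have h1 := h (d + 1)
  rw [card_upShadow_monsIn hU hx, card_monsIn_succ hx, ← hp] at h1
  have hunion : C ∪ lexSeg (V.erase x) (d + 1) (lexGrowth #(V.erase x) d q) =
      lexSeg (V.erase x) (d + 1) (max p (lexGrowth #(V.erase x) d q)) := by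
    rcases le_total p (lexGrowth #(V.erase x) d q) with hpq | hpq
    · rw [max_eq_right hpq, union_eq_right]; exact lexSeg_mono _ _ hpq
    · rw [max_eq_left hpq, union_eq_left]; exact lexSeg_mono _ _ hpq
  have h2 := IsStable.card_upShadow_union_mulVar hx hCs hE hst
  rw [hw, upShadow_lexSeg hqle, hunion, card_lexSeg (max_le hple (lexGrowth_le _ _ _)),
    card_upShadow_lexSeg hple] at h2
  -- The rearranged set has as many elements as the layer of the Gotzmann ideal, so its shadow is at
  -- least as large; the common term `#E` then cancels.
  have h3 := lexGrowth_le_card_upShadow V (d + 1) (C ∪ mulVar x E)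
    (union_subset (hCs.trans (finsuppAntidiag_mono (erase_subset _ _) _))
      (mulVar_subset_mons hx hE))
  rw [card_union_of_disjoint (disjoint_mulVar hCs _), card_mulVar, card_lexSeg hple] at h3
  rw [hc] at h2 h3
  omega

theorem card_upShadow_deg_zero_le (V : Finset ι) (U : Set (Finset ι)) :
    #(upShadow V (monsIn V U 0)) ≤ lexGrowth #V 0 #(monsIn V U 0) := by
  have h := monsIn_subset V U 0
  rw [mons_zero, subset_singleton_iff] at h
  rcases h with h | h
  · simp [h]
  · rw [h, ← mons_zero V, upShadow_mons, card_mons, card_mons, lexGrowth_full]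

/-- In `GotzmannOn.card_add_card_le` each summand on the left is at least the matching one on the
right, so both are equalities. The first gives this result, the second gives `GotzmannOn.subset_or`.
-/
theorem GotzmannOn.erase {V : Finset ι} {U : Set (Finset ι)} (h : GotzmannOn V U)
    (hU : IsUpperSet U) {x : ι} (hx : x ∈ V) : GotzmannOn (V.erase x) U := by
  intro d
  cases d with
  | zero => exact card_upShadow_deg_zero_le _ _
  | succ d =>
    have h1 := h.card_add_card_le hU hx d
    have h2 := lexGrowth_le_card_upShadow (V.erase x) d _ (monsIn_subset _ (link x U) d)
    have h3 := card_le_card (subset_union_left (s₁ := monsIn (V.erase x) U (d + 1))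
      (s₂ := upShadow (V.erase x) (monsIn (V.erase x) (link x U) d)))
    have h4 := card_le_card (subset_union_right (s₁ := monsIn (V.erase x) U (d + 1))
      (s₂ := upShadow (V.erase x) (monsIn (V.erase x) (link x U) d)))
    omega

/-- The union of the `x`-free layer and the shadow of the restricted colon has the size of the
larger of the two lower bounds, so it equals one of its parts. In the second case the shadow is
moreover minimal. -/
theorem GotzmannOn.subset_or {V : Finset ι} {U : Set (Finset ι)} (h : GotzmannOn V U)
    (hU : IsUpperSet U) {x : ι} (hx : x ∈ V) (d : ℕ) :
    upShadow (V.erase x) (monsIn (V.erase x) (link x U) d) ⊆ monsIn (V.erase x) U (d + 1) ∨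
    (monsIn (V.erase x) U (d + 1) ⊆ upShadow (V.erase x) (monsIn (V.erase x) (link x U) d) ∧
      #(upShadow (V.erase x) (monsIn (V.erase x) (link x U) d)) ≤
        lexGrowth #(V.erase x) d #(monsIn (V.erase x) (link x U) d)) := by
  have h1 := h.card_add_card_le hU hx d
  have h2 := lexGrowth_le_card_upShadow (V.erase x) d _ (monsIn_subset _ (link x U) d)
  have h3 := lexGrowth_le_card_upShadow (V.erase x) (d + 1) _ (monsIn_subset _ U (d + 1))
  set P := monsIn (V.erase x) U (d + 1)
  set T := upShadow (V.erase x) (monsIn (V.erase x) (link x U) d)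
  rcases max_cases #P (lexGrowth #(V.erase x) d #(monsIn (V.erase x) (link x U) d)) with hm | hm
  · left
    have : P = P ∪ T := eq_of_subset_of_card_le subset_union_left (by omega)
    rw [this]; exact subset_union_right
  · right
    have h4 := card_le_card (subset_union_right : T ⊆ P ∪ T)
    have : T = P ∪ T := eq_of_subset_of_card_le subset_union_right (by omega)
    exact ⟨by rw [this]; exact subset_union_left, by omega⟩

/-- Multiplying by a variable already in the support does not change the support, so membership
descends from degree `d + 2`. Positive degree provides such a variable. -/
theorem monsIn_link_eq {U : Set (Finset ι)} (hU : IsUpperSet U) {V : Finset ι} {x : ι} {d : ℕ}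
    (h : upShadow V (monsIn V (link x U) (d + 1)) ⊆ monsIn V U (d + 2)) :
    monsIn V (link x U) (d + 1) = monsIn V U (d + 1) := by
  ext a
  simp only [mem_monsIn, and_congr_right_iff]
  intro ha
  refine ⟨fun hs => ?_, fun hs => hU (subset_insert _ _) hs⟩
  have h0 : a ≠ 0 := by rintro rfl; simp at ha
  obtain ⟨i, hi⟩ := Finsupp.support_nonempty_iff.2 h0
  have := h (add_single_mem_upShadow (mem_monsIn.2 ⟨ha, hs⟩) ((mem_mons.1 ha).2 hi))
  rw [mem_monsIn, support_add_single, insert_eq_of_mem hi] at this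
  exact this.2


/-- In positive degree, either the colon agrees with the restriction, or the latter lies in the
shadow of the former. -/
theorem GotzmannOn.eq_or_subset {V : Finset ι} {U : Set (Finset ι)} (h : GotzmannOn V U)
    (hU : IsUpperSet U) {x : ι} (hx : x ∈ V) (d : ℕ) :
    monsIn (V.erase x) (link x U) (d + 1) = monsIn (V.erase x) U (d + 1) ∨
    monsIn (V.erase x) U (d + 2) ⊆
      upShadow (V.erase x) (monsIn (V.erase x) (link x U) (d + 1)) := by
  rcases h.subset_or hU hx (d + 1) with h1 | h1
  · exact .inl (monsIn_link_eq hU h1)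
  · exact .inr h1.1

theorem GotzmannOn.link {V : Finset ι} {U : Set (Finset ι)} (h : GotzmannOn V U)
    (hU : IsUpperSet U) {x : ι} (hx : x ∈ V) : GotzmannOn (V.erase x) (link x U) := by
  intro d
  cases d with
  | zero => exact card_upShadow_deg_zero_le _ _
  | succ d =>
    rcases h.subset_or hU hx (d + 1) with h1 | h1
    · rw [monsIn_link_eq hU h1]
      exact h.erase hU hx (d + 1)
    · exact h1.2

end SquarefreeSets

end GotzmannEGF

/-! ### Structure: a Gotzmann ideal contains a variable or is divisible by one. -/

namespace GotzmannEGF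

open Finset

theorem multichoose_succ_pos (n d : ℕ) : 0 < Nat.multichoose (n + 1) d := by
  induction d with
  | zero => simp
  | succ d ih => rw [multichoose_succ_succ']; omega

theorem lexGrowth_one (n d : ℕ) : lexGrowth (n + 1) d 1 = n + 1 := by
  induction d with
  | zero => simp [lexGrowth_deg_zero]
  | succ d ih => rw [lexGrowth_succ_deg (multichoose_succ_pos n d), ih]

section Structure

variable {ι : Type*} [DecidableEq ι]

theorem single_mem_monsIn_one {V : Finset ι} {U : Set (Finset ι)} {z : ι} (hz : z ∈ V) :
    Finsupp.single z 1 ∈ monsIn V U 1 ↔ {z} ∈ U := by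
  rw [mem_monsIn, mem_mons, Finsupp.support_single _ one_ne_zero]
  simp [hz]

theorem exists_single_of_mem_mons_one {V : Finset ι} {a : ι →₀ ℕ} (ha : a ∈ mons V 1) :
    ∃ z ∈ V, a = .single z 1 := by
  rw [mem_mons] at ha
  have : a ∈ {d : ι →₀ ℕ | d.degree = 1} := ha.1
  rw [← Finsupp.range_single_one] at this
  obtain ⟨z, rfl⟩ := this
  exact ⟨z, ha.2 (by simp), rfl⟩

theorem single_add_single_mem_monsIn_two {V : Finset ι} {U : Set (Finset ι)} {u w : ι}
    (hu : u ∈ V) (hw : w ∈ V) :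
    Finsupp.single u 1 + Finsupp.single w 1 ∈ monsIn V U 2 ↔ {w, u} ∈ U := by
  rw [add_single_mem_monsIn hw, single_mem_monsIn_one hu, mem_link]

/-- The neighbour `z` lies in the colon by `x` but not in the ideal, which excludes equality in
`GotzmannOn.eq_or_subset`. So `u * w` is a multiple of a variable in the colon, necessarily `u` or
`w`. -/
theorem GotzmannOn.edge {V : Finset ι} {U : Set (Finset ι)} (h : GotzmannOn V U)
    (hU : IsUpperSet U) (h1 : ∀ y ∈ V, {y} ∉ U) {x z u w : ι} (hx : x ∈ V) (hz : z ∈ V)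
    (hu : u ∈ V) (hw : w ∈ V) (hzx : z ≠ x) (hux : u ≠ x) (hwx : w ≠ x) (hxz : {x, z} ∈ U)
    (huw : {u, w} ∈ U) : {x, u} ∈ U ∨ {x, w} ∈ U := by
  have hz' : z ∈ V.erase x := mem_erase.2 ⟨hzx, hz⟩
  rcases h.eq_or_subset hU hx 0 with h2 | h2
  · have : Finsupp.single z 1 ∈ monsIn (V.erase x) (GotzmannEGF.link x U) 1 :=
      (single_mem_monsIn_one hz').2 hxz
    rw [h2] at this
    exact absurd ((single_mem_monsIn_one hz').1 this) (h1 z hz)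
  · have h3 := h2 ((single_add_single_mem_monsIn_two (mem_erase.2 ⟨hwx, hw⟩)
      (mem_erase.2 ⟨hux, hu⟩)).2 huw)
    obtain ⟨a, ha, i, -, hai⟩ := mem_upShadow.1 h3
    obtain ⟨j, hj, rfl⟩ := exists_single_of_mem_mons_one (monsIn_subset _ _ _ ha)
    have hjU := (single_mem_monsIn_one hj).1 ha
    have hjs : j ∈ (Finsupp.single w 1 + Finsupp.single u 1 : ι →₀ ℕ).support := by
      rw [← hai]; simp
    rw [support_add_single, Finsupp.support_single _ one_ne_zero, mem_insert,
      mem_singleton] at hjs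
    rcases hjs with rfl | rfl
    · exact .inl hjU
    · exact .inr hjU

/-- The ideal `(y z₁, …, y z_c, z₁ ⋯ z_c)`, `c ≥ 2`, is not Gotzmann. -/
theorem not_gotzmannOn_star {V : Finset ι} {U : Set (Finset ι)} (hU : IsUpperSet U) {y : ι}
    (hy : y ∈ V) (hyU : {y} ∉ U) (hc : 2 ≤ #(V.erase y)) (hz : ∀ z ∈ V.erase y, {y, z} ∈ U)
    (hV : V.erase y ∈ U) (hs : ∀ s ⊆ V, s ∈ U → y ∉ s → s = V.erase y) : ¬ GotzmannOn V U := by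
  intro h
  obtain ⟨d, hd⟩ := Nat.exists_eq_add_of_le' hc
  have hcV : #V = #(V.erase y) + 1 := by rw [card_erase_add_one hy]
  have hpos : ∀ a ∈ mons (V.erase y) (d + 2), a.support ∈ U → ∀ z ∈ V.erase y, a z = 1 := by
    intro a ha hsU
    have hsupp := (mem_mons.1 ha).2
    have heq : a.support = V.erase y :=
      hs _ (hsupp.trans (erase_subset _ _)) hsU fun hya => (mem_erase.1 (hsupp hya)).1 rfl
    have hsum := (mem_finsuppAntidiag.1 ha).1
    rw [← hd, card_eq_sum_ones] at hsum
    have := (sum_eq_sum_iff_of_le (s := V.erase y) (f := fun _ => 1) (g := a) fun i hi => by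
      rw [← heq] at hi
      exact Nat.one_le_iff_ne_zero.2 (Finsupp.mem_support_iff.1 hi)).1 hsum.symm
    exact fun z hz => (this z hz).symm
  have hP : #(monsIn (V.erase y) U (d + 2)) = 1 := by
    refine le_antisymm (card_le_one.2 ?_) (card_pos.2 ⟨∑ z ∈ V.erase y, .single z 1, ?_⟩)
    · intro a ha b hb
      rw [mem_monsIn] at ha hb
      ext z
      by_cases hzV : z ∈ V.erase y
      · rw [hpos a ha.1 ha.2 z hzV, hpos b hb.1 hb.2 z hzV]
      · rw [Finsupp.notMem_support_iff.1 fun hza => hzV ((mem_mons.1 ha.1).2 hza),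
          Finsupp.notMem_support_iff.1 fun hzb => hzV ((mem_mons.1 hb.1).2 hzb)]
    · have hsupp : (∑ z ∈ V.erase y, Finsupp.single z 1 : ι →₀ ℕ).support = V.erase y := by
        ext j
        simp [Finsupp.finsetSum_apply, Finsupp.single_apply]
      rw [mem_monsIn, mem_mons, hsupp]
      refine ⟨⟨?_, subset_rfl⟩, hV⟩
      rw [map_sum]
      simp [← hd]
  have hQ : monsIn (V.erase y) (link y U) (d + 1) = mons (V.erase y) (d + 1) := by
    refine (monsIn_subset _ _ _).antisymm fun a ha => mem_monsIn.2 ⟨ha, ?_⟩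
    have h0 : a ≠ 0 := by rintro rfl; simp at ha
    obtain ⟨i, hi⟩ := Finsupp.support_nonempty_iff.2 h0
    exact hU (insert_subset_insert _ (singleton_subset_iff.2 hi)) (hz i ((mem_mons.1 ha).2 hi))
  have hE : monsIn V (link y U) (d + 1) = (mons V (d + 1)).erase (.single y (d + 1)) := by
    ext a
    rw [mem_monsIn, mem_erase, and_comm, mem_link]
    refine and_congr_left fun ha => ⟨?_, fun hne => ?_⟩
    · rintro h1 rfl
      rw [Finsupp.support_single _ (Nat.succ_ne_zero d)] at h1
      exact hyU (by simpa using h1)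
    · obtain ⟨i, hi, hiy⟩ : ∃ i ∈ a.support, i ≠ y := by
        by_contra hcon
        push Not at hcon
        apply hne
        have hsub : a.support ⊆ {y} := fun i hi => mem_singleton.2 (hcon i hi)
        obtain ⟨r, rfl⟩ := Finsupp.support_subset_singleton'.1 hsub
        have := (mem_mons.1 ha).1
        rw [Finsupp.degree_single] at this
        rw [this]
      exact hU (insert_subset_insert _ (singleton_subset_iff.2 hi))
        (hz i (mem_erase.2 ⟨hiy, (mem_mons.1 ha).2 hi⟩))
  have hEc : #(monsIn V (link y U) (d + 1)) + 1 = Nat.multichoose #V (d + 1) := by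
    rw [hE, card_erase_add_one, card_mons]
    rw [mem_mons, Finsupp.degree_single, Finsupp.support_single _ (Nat.succ_ne_zero d)]
    simpa using hy
  -- Let `c = #(V.erase y) = d + 2`. In degree `c` the ideal has exactly as many monomials as there
  -- are multiples of one variable, because `z₁ ⋯ z_c` makes up for the missing `y ^ c`. Its shadow
  -- exceeds the lexicographic growth by at least `c - 1`.
  have h1 := h (d + 2)
  rw [card_upShadow_monsIn hU hy (d + 1), card_monsIn_succ hy U (d + 1), hP, add_comm 1, hEc,
    lexGrowth_succ_deg le_rfl, lexGrowth_full, hQ, upShadow_mons,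
    union_eq_right.2 (monsIn_subset _ _ _), card_mons, hcV, multichoose_succ_succ' _ (d + 1),
    ← hcV] at h1
  have h2 := lexGrowth_le_card_upShadow (V.erase y) _ _ (monsIn_subset _ U (d + 2))
  rw [hP, hd, lexGrowth_one] at h2
  simp only [show d + 1 + 1 = d + 2 from rfl] at h1
  omega

/-- The edge ideal `(x t, x w, y t, y w)` of a 4-cycle is not Gotzmann. -/
theorem not_gotzmannOn_cycle {V : Finset ι} {U : Set (Finset ι)} (hU : IsUpperSet U)
    {x y t w : ι} (hV : V = {x, y, t, w}) (hxy : x ≠ y) (hxt : x ≠ t) (hxw : x ≠ w)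
    (hyt : y ≠ t) (hyw : y ≠ w) (htw : t ≠ w) (h1 : {x, t} ∈ U) (h2 : {x, w} ∈ U)
    (h3 : {y, t} ∈ U) (h4 : {y, w} ∈ U) (hc1 : ∀ s ⊆ V, s ∈ U → x ∈ s ∨ y ∈ s)
    (hc2 : ∀ s ⊆ V, s ∈ U → t ∈ s ∨ w ∈ s) : ¬ GotzmannOn V U := by
  intro h
  have hx : x ∈ V := by simp [hV]
  have hy : y ∈ V := by simp [hV]
  have ht : t ∈ V.erase x := by simp [hV, hxt.symm]
  have hw : w ∈ V.erase x := by simp [hV, hxw.symm]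
  have hy' : y ∈ V.erase x := by simp [hV, hxy.symm]
  have hcV : #V = 4 := by
    rw [hV]; simp [card_insert_of_notMem, hxy, hxt, hxw, hyt, hyw, htw]
  have hcV' : #(V.erase x) = 3 := by rw [card_erase_of_mem hx, hcV]
  have hQ : monsIn (V.erase x) (link x U) 1 = {.single t 1, .single w 1} := by
    ext a
    rw [mem_insert, mem_singleton]
    constructor
    · intro ha
      obtain ⟨z, hz, rfl⟩ := exists_single_of_mem_mons_one (monsIn_subset _ _ _ ha)
      have hzU := (single_mem_monsIn_one hz).1 ha
      have := hc2 {x, z} (by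
        intro j hj
        rw [mem_insert, mem_singleton] at hj
        rcases hj with rfl | rfl
        · exact hx
        · exact mem_of_mem_erase hz) hzU
      simp only [mem_insert, mem_singleton, hxt.symm, hxw.symm, false_or] at this
      rcases this with rfl | rfl <;> simp
    · rintro (rfl | rfl)
      · exact (single_mem_monsIn_one ht).2 h1
      · exact (single_mem_monsIn_one hw).2 h2
  have hP : monsIn (V.erase x) U 2 = {.single t 1 + .single y 1, .single w 1 + .single y 1} := by
    ext a
    rw [mem_insert, mem_singleton]
    constructor
    · intro ha
      rw [mem_monsIn] at ha
      have hsub := (mem_mons.1 ha.1).2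
      have hsV := hsub.trans (erase_subset _ _)
      have hxa : x ∉ a.support := fun hxa => (mem_erase.1 (hsub hxa)).1 rfl
      have hya : y ∈ a.support := (hc1 _ hsV ha.2).resolve_left hxa
      obtain ⟨b, rfl⟩ := exists_eq_add_single (Finsupp.mem_support_iff.1 hya)
      obtain ⟨z, hz, rfl⟩ := exists_single_of_mem_mons_one ((add_single_mem_mons hy').1 ha.1)
      have := hc2 _ hsV ha.2
      rw [support_add_single, Finsupp.support_single _ one_ne_zero] at this
      simp only [mem_insert, mem_singleton, hyt.symm, hyw.symm, false_or] at this
      rcases this with rfl | rfl <;> simp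
    · rintro (rfl | rfl)
      · exact (single_add_single_mem_monsIn_two ht hy').2 h3
      · exact (single_add_single_mem_monsIn_two hw hy').2 h4
  have hinj : (Finsupp.single t 1 : ι →₀ ℕ) ≠ .single w 1 := fun he =>
    htw (Finsupp.single_left_injective one_ne_zero he)
  have hQc : #(monsIn (V.erase x) (link x U) 1) = 2 := by rw [hQ, card_pair hinj]
  have hPc : #(monsIn (V.erase x) U 2) = 2 := by
    rw [hP, card_pair fun he => hinj (add_right_cancel he)]
  have h0 : #(monsIn V (link x U) 0) = 0 := by
    rw [card_eq_zero, ← subset_empty]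
    intro a ha
    rw [mem_monsIn, mons_zero, mem_singleton] at ha
    obtain ⟨rfl, ha⟩ := ha
    have hxU : {x} ∈ U := by simpa [mem_link] using ha
    have := hc2 {x} (singleton_subset_iff.2 hx) hxU
    simp [hxt.symm, hxw.symm] at this
  have hEc : #(monsIn V (link x U) 1) = 2 := by
    rw [card_monsIn_succ hx, link_link, h0, hQc]
  -- In degree 2 the shadow has at least `5 + 5 + 2` elements, while four quadrics in lexicographic
  -- position grow only to 10.
  have hL := h 2
  rw [card_upShadow_monsIn hU hx 1, card_monsIn_succ hx U 1, hEc, hPc, hcV,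
    lexGrowth_succ_deg (by simp)] at hL
  have hP2 := lexGrowth_le_card_upShadow (V.erase x) _ _ (monsIn_subset _ U 2)
  have hQ2 := lexGrowth_le_card_upShadow (V.erase x) _ _ (monsIn_subset _ (link x U) 1)
  have hu := card_le_card (subset_union_right (s₁ := monsIn (V.erase x) U 2)
    (s₂ := upShadow (V.erase x) (monsIn (V.erase x) (link x U) 1)))
  have h5 : lexGrowth 3 1 2 = 5 := by simp [lexGrowth]
  rw [hPc, hcV', lexGrowth_succ_deg (by simp), h5] at hP2
  rw [hQc, hcV', h5] at hQ2
  have h10 : lexGrowth 4 1 4 = 10 := by simp [lexGrowth]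
  simp only [Nat.reduceAdd] at hL
  rw [h10] at hL
  omega

/-- The final case distinction: vertex covers with two elements and edges. -/
theorem not_gotzmannOn_of_covers {V : Finset ι} {U : Set (Finset ι)} (hU : IsUpperSet U)
    (hne : V.Nonempty) (h0 : ∅ ∉ U) (h1 : ∀ y ∈ V, {y} ∉ U)
    (hd : ∀ y ∈ V, ∃ s ⊆ V, s ∈ U ∧ y ∉ s)
    (he : ∀ x ∈ V, ∃ z ∈ V, z ≠ x ∧ {x, z} ∈ U)
    (hcov : ∀ x ∈ V, ∃ y ∈ V, y ≠ x ∧ ∀ s ⊆ V, s ∈ U → x ∈ s ∨ y ∈ s) : ¬ GotzmannOn V U := by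
  intro h
  have hpair : ∀ {u w : ι}, u ∈ V → w ∈ V → ({u, w} : Finset ι) ⊆ V := fun hu hw =>
    insert_subset hu (singleton_subset_iff.2 hw)
  have hedge : ∀ x ∈ V, ∀ u ∈ V, ∀ w ∈ V, u ≠ x → w ≠ x → {u, w} ∈ U →
      {x, u} ∈ U ∨ {x, w} ∈ U := by
    intro x hx u hu w hw hux hwx huw
    obtain ⟨z, hz, hzx, hxz⟩ := he x hx
    exact h.edge hU h1 hx hz hu hw hzx hux hwx hxz huw
  -- all pairs containing `y` are covers
  have caseA : ∀ x ∈ V, ∀ y ∈ V, x ≠ y → (∀ s ⊆ V, s ∈ U → x ∈ s ∨ y ∈ s) →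
      (∀ t ∈ V, t ≠ x → t ≠ y → ∀ s ⊆ V, s ∈ U → t ∈ s ∨ y ∈ s) → False := by
    intro x hx y hy hxy hcxy hct
    have hs : ∀ s ⊆ V, s ∈ U → y ∉ s → s = V.erase y := by
      intro s hsV hsU hys
      refine (subset_erase.2 ⟨hsV, hys⟩).antisymm fun t ht => ?_
      rw [mem_erase] at ht
      by_cases htx : t = x
      · exact htx ▸ (hcxy s hsV hsU).resolve_right hys
      · exact (hct t ht.2 htx ht.1 s hsV hsU).resolve_right hys
    have hVU : V.erase y ∈ U := by
      obtain ⟨s, hsV, hsU, hys⟩ := hd y hy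
      exact hs s hsV hsU hys ▸ hsU
    refine not_gotzmannOn_star hU hy (h1 y hy) ?_ ?_ hVU hs h
    · by_contra hlt
      have : #(V.erase y) = 0 ∨ #(V.erase y) = 1 := by omega
      rcases this with h2 | h2
      · rw [card_eq_zero] at h2; exact h0 (h2 ▸ hVU)
      · obtain ⟨z, hz⟩ := card_eq_one.1 h2
        have hzV : z ∈ V.erase y := by simp [hz]
        exact h1 z (mem_of_mem_erase hzV) (hz ▸ hVU)
    · intro z hz
      obtain ⟨hzy, hzV⟩ := mem_erase.1 hz
      obtain ⟨w, hw, hwz, hzw⟩ := he z hzV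
      by_cases hwy : w = y
      · rw [pair_comm, ← hwy]; exact hzw
      · have h2 := hs _ (hpair hzV hw) hzw (by simp [Ne.symm hzy, Ne.symm hwy])
        obtain ⟨s, hsV, hsU, hws⟩ := hd w hw
        refine hU (fun j hj => ?_) hsU
        by_cases hjy : j = y
        · simp [hjy]
        · have : j ∈ V.erase y := mem_erase.2 ⟨hjy, hsV hj⟩
          rw [← h2, mem_insert, mem_singleton] at this
          rcases this with rfl | rfl
          · simp
          · exact absurd hj hws
  -- two disjoint covers
  have caseB : ∀ x ∈ V, ∀ y ∈ V, ∀ t ∈ V, ∀ w ∈ V, x ≠ y → t ≠ w → t ≠ x → t ≠ y → w ≠ x →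
      w ≠ y → (∀ s ⊆ V, s ∈ U → x ∈ s ∨ y ∈ s) → (∀ s ⊆ V, s ∈ U → t ∈ s ∨ w ∈ s) →
      {x, t} ∈ U → False := by
    intro x hx y hy t ht w hw hxy htw htx hty hwx hwy hc1 hc2 hxt
    have hVeq : V = {x, y, t, w} := by
      ext v
      simp only [mem_insert, mem_singleton]
      refine ⟨fun hv => ?_, ?_⟩
      · by_contra hcon
        push Not at hcon
        obtain ⟨z, hz, -, hvz⟩ := he v hv
        have h2 := hc1 _ (hpair hv hz) hvz
        have h3 := hc2 _ (hpair hv hz) hvz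
        simp only [mem_insert, mem_singleton] at h2 h3
        grind
      · rintro (rfl | rfl | rfl | rfl) <;> assumption
    have hyt : {y, t} ∈ U := by
      rcases hedge y hy x hx t ht hxy hty hxt with h2 | h2
      · have := hc2 _ (hpair hy hx) h2
        simp [hty, htx, hwy, hwx] at this
      · exact h2
    have hxw : {x, w} ∈ U := by
      rcases hedge w hw x hx t ht (Ne.symm hwx) htw hxt with h2 | h2
      · rw [pair_comm]; exact h2
      · have := hc1 _ (hpair hw ht) h2
        simp [Ne.symm hty, Ne.symm htx, Ne.symm hwy, Ne.symm hwx] at this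
    have hyw : {y, w} ∈ U := by
      rcases hedge y hy x hx w hw hxy hwy hxw with h2 | h2
      · have := hc2 _ (hpair hy hx) h2
        simp [hty, htx, hwy, hwx] at this
      · exact h2
    exact not_gotzmannOn_cycle hU hVeq hxy (Ne.symm htx) (Ne.symm hwx) (Ne.symm hty)
      (Ne.symm hwy) htw hxt hxw hyt hyw hc1 hc2 h
  obtain ⟨x, hx⟩ := hne
  obtain ⟨y, hy, hyx, hcxy⟩ := hcov x hx
  have hcyx : ∀ s ⊆ V, s ∈ U → y ∈ s ∨ x ∈ s := fun s h2 h3 => (hcxy s h2 h3).symm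
  have hpart : ∀ t ∈ V, t ≠ x → t ≠ y → (∀ s ⊆ V, s ∈ U → t ∈ s ∨ x ∈ s) ∨
      (∀ s ⊆ V, s ∈ U → t ∈ s ∨ y ∈ s) := by
    intro t ht htx hty
    obtain ⟨w, hw, hwt, hct⟩ := hcov t ht
    by_cases hwx : w = x
    · exact .inl (hwx ▸ hct)
    by_cases hwy : w = y
    · exact .inr (hwy ▸ hct)
    exfalso
    have hcw : ∀ s ⊆ V, s ∈ U → w ∈ s ∨ t ∈ s := fun s h2 h3 => (hct s h2 h3).symm
    obtain ⟨z, hz, hzx, hxz⟩ := he x hx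
    have h2 := hct _ (hpair hx hz) hxz
    simp only [mem_insert, mem_singleton, htx, hwx, false_or] at h2
    rcases h2 with rfl | rfl
    · exact caseB x hx y hy t ht w hw (Ne.symm hyx) (Ne.symm hwt) htx hty hwx hwy hcxy hct hxz
    · exact caseB x hx y hy w hw t ht (Ne.symm hyx) hwt hwx hwy htx hty hcxy hcw hxz
  by_cases hA : ∀ t ∈ V, t ≠ x → t ≠ y → ∀ s ⊆ V, s ∈ U → t ∈ s ∨ y ∈ s
  · exact caseA x hx y hy (Ne.symm hyx) hcxy hA
  by_cases hA' : ∀ t ∈ V, t ≠ y → t ≠ x → ∀ s ⊆ V, s ∈ U → t ∈ s ∨ x ∈ s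
  · exact caseA y hy x hx hyx hcyx hA'
  -- What remains are covers `{x, y}`, `{t, x}`, `{t', y}`. They force the edge at `t` to be `{t,
  -- y}`, and then the edge rule at `t'` yields `{t', t}` or `{t', y}`, each of which misses a
  -- cover.
  simp only [not_forall] at hA hA'
  obtain ⟨t, ht, htx, hty, s1, hs1, hs1U, hs1n⟩ := hA
  obtain ⟨t', ht', ht'y, ht'x, s2, hs2, hs2U, hs2n⟩ := hA'
  have hct := (hpart t ht htx hty).resolve_right fun h2 => hs1n (h2 s1 hs1 hs1U)
  have hct' := (hpart t' ht' ht'x ht'y).resolve_left fun h2 => hs2n (h2 s2 hs2 hs2U)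
  have htt' : t ≠ t' := by rintro rfl; exact hs2n (hct s2 hs2 hs2U)
  have hty' : {t, y} ∈ U := by
    obtain ⟨z, hz, -, htz⟩ := he t ht
    have h2 := hcxy _ (hpair ht hz) htz
    have h3 := hct' _ (hpair ht hz) htz
    simp only [mem_insert, mem_singleton] at h2 h3
    have : z = y := by grind
    exact this ▸ htz
  rcases hedge t' ht' t ht y hy htt' (Ne.symm ht'y) hty' with h2 | h2
  · have := hcxy _ (hpair ht' ht) h2
    simp only [mem_insert, mem_singleton] at this
    grind
  · have := hct _ (hpair ht' hy) h2
    simp only [mem_insert, mem_singleton] at this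
    grind

/-- A nonzero proper squarefree Gotzmann ideal contains a variable or is contained in the ideal
generated by a variable. -/
theorem GotzmannOn.cases {V : Finset ι} {U : Set (Finset ι)} (h : GotzmannOn V U)
    (hU : IsUpperSet U) : (∀ s ⊆ V, s ∉ U) ∨ ∅ ∈ U ∨ (∃ y ∈ V, {y} ∈ U) ∨
      ∃ y ∈ V, ∀ s ⊆ V, s ∈ U → y ∈ s := by
  induction hn : #V using Nat.strong_induction_on generalizing V U with
  | _ n ih =>
    have hlt : ∀ x ∈ V, #(V.erase x) < n := fun x hx => hn ▸ card_erase_lt_of_mem hx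
    by_contra hcon
    push Not at hcon
    obtain ⟨⟨s₀, hs₀, hs₀U⟩, h0, h1, hd⟩ := hcon
    -- Every variable divides a minimal generator; otherwise the restriction to the other variables
    -- would be a smaller counterexample.
    have hsupp : ∀ x ∈ V, ∃ s ⊆ V.erase x, insert x s ∈ U ∧ s ∉ U := by
      intro x hx
      by_contra hcon
      push Not at hcon
      have herase : ∀ s ⊆ V, s ∈ U → s.erase x ∈ U := fun s hs hsU =>
        hcon _ (erase_subset_erase x hs) (hU (subset_insert_iff.2 subset_rfl) hsU)
      rcases ih _ (hlt x hx) (h.erase hU hx) hU rfl with h2 | h2 | ⟨y, hy, h2⟩ | ⟨y, hy, h2⟩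
      · exact h2 _ (erase_subset_erase x hs₀) (herase _ hs₀ hs₀U)
      · exact h0 h2
      · exact h1 y (mem_of_mem_erase hy) h2
      · obtain ⟨s, hs, hsU, hys⟩ := hd y (mem_of_mem_erase hy)
        exact hys (mem_of_mem_erase (h2 _ (erase_subset_erase x hs) (herase s hs hsU)))
    have hsub : ∀ x s, s ⊆ V → s.erase x ⊆ V.erase x := fun x s hs => erase_subset_erase x hs
    -- Induction applied to the colon by `x` gives an edge at `x`; applied to the restriction it
    -- gives a variable common to all members avoiding `x`, that is, a two-element cover containing
    -- `x`.
    refine not_gotzmannOn_of_covers hU ?_ h0 h1 hd ?_ ?_ h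
    · rw [nonempty_iff_ne_empty]
      rintro rfl
      exact h0 (subset_empty.1 hs₀ ▸ hs₀U)
    · intro x hx
      rcases ih _ (hlt x hx) (h.link hU hx) (isUpperSet_link hU x) rfl with
        h2 | h2 | ⟨z, hz, h2⟩ | ⟨y, hy, h2⟩
      · obtain ⟨s, hs, hsU, -⟩ := hsupp x hx
        exact absurd hsU (h2 s hs)
      · exact absurd h2 (by simpa [mem_link] using h1 x hx)
      · exact ⟨z, mem_of_mem_erase hz, (mem_erase.1 hz).1, h2⟩
      · obtain ⟨s, hs, hsU, hys⟩ := hd y (mem_of_mem_erase hy)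
        exact absurd (mem_of_mem_erase (h2 _ (hsub x s hs)
          (hU (subset_insert_iff.2 subset_rfl) hsU))) hys
    · intro x hx
      rcases ih _ (hlt x hx) (h.erase hU hx) hU rfl with h2 | h2 | ⟨z, hz, h2⟩ | ⟨y, hy, h2⟩
      · obtain ⟨s, hs, hsU, hxs⟩ := hd x hx
        exact absurd hsU (h2 s (subset_erase.2 ⟨hs, hxs⟩))
      · exact absurd h2 h0
      · exact absurd h2 (h1 z (mem_of_mem_erase hz))
      · refine ⟨y, mem_of_mem_erase hy, (mem_erase.1 hy).1, fun s hs hsU => ?_⟩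
        by_cases hxs : x ∈ s
        · exact .inl hxs
        · exact .inr (h2 s (subset_erase.2 ⟨hs, hxs⟩) hsU)

end Structure

end GotzmannEGF

/-! ### The class generated by multiplying by and adding new variables. -/

namespace GotzmannEGF

open Finset

section Class

variable {ι : Type*} [DecidableEq ι]

theorem monsIn_congr {V : Finset ι} {U U' : Set (Finset ι)} (h : ∀ s ⊆ V, s ∈ U ↔ s ∈ U')
    (d : ℕ) : monsIn V U d = monsIn V U' d := by
  ext a
  rw [mem_monsIn, mem_monsIn]
  exact and_congr_right fun ha => h _ (mem_mons.1 ha).2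

theorem GotzmannOn.congr {V : Finset ι} {U U' : Set (Finset ι)} (h : GotzmannOn V U)
    (hU : ∀ s ⊆ V, s ∈ U ↔ s ∈ U') : GotzmannOn V U' := by
  intro d
  rw [← monsIn_congr hU]
  exact h d

theorem monsIn_of_empty_mem {V : Finset ι} {U : Set (Finset ι)} (hU : IsUpperSet U)
    (h : ∅ ∈ U) (d : ℕ) : monsIn V U d = mons V d :=
  (monsIn_subset _ _ _).antisymm fun _ ha => mem_monsIn.2 ⟨ha, hU (empty_subset _) h⟩

theorem gotzmannOn_of_empty_mem {V : Finset ι} {U : Set (Finset ι)} (hU : IsUpperSet U)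
    (h : ∅ ∈ U) : GotzmannOn V U := by
  intro d
  rw [monsIn_of_empty_mem hU h, upShadow_mons, card_mons, card_mons, lexGrowth_full]

theorem gotzmannOn_of_forall_notMem {V : Finset ι} {U : Set (Finset ι)}
    (h : ∀ s ⊆ V, s ∉ U) : GotzmannOn V U := by
  intro d
  have : monsIn V U d = ∅ := by
    rw [← subset_empty]
    intro a ha
    rw [mem_monsIn] at ha
    exact absurd ha.2 (h _ (mem_mons.1 ha.1).2)
  simp [this]

/-- Multiplication by `x` shifts the degree by one, and `lexGrowth_succ_deg` shows that the bound
shifts in the same way. -/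
theorem GotzmannOn.of_link {V : Finset ι} {U : Set (Finset ι)} {x : ι} (hx : x ∈ V)
    (hxU : ∀ s ∈ U, x ∈ s) (h : GotzmannOn V (GotzmannEGF.link x U)) : GotzmannOn V U := by
  intro d
  cases d with
  | zero => exact card_upShadow_deg_zero_le _ _
  | succ d =>
    have : monsIn V U (d + 1) = mulVar x (monsIn V (GotzmannEGF.link x U) d) := by
      rw [monsIn_succ hx, union_eq_right]
      intro a ha
      rw [mem_monsIn] at ha
      exact absurd rfl (mem_erase.1 ((mem_mons.1 ha.1).2 (hxU _ ha.2))).1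
    rw [this, upShadow_mulVar, card_mulVar, card_mulVar,
      lexGrowth_succ_deg (card_le_multichoose (monsIn_subset _ _ _))]
    exact h d

/-- A layer is all multiples of `x` plus a layer in the other variables, the same shape as a long
lexicographic segment; `lexGrowth_add` matches the two. -/
theorem GotzmannOn.of_erase {V : Finset ι} {U : Set (Finset ι)} (hU : IsUpperSet U) {x : ι}
    (hx : x ∈ V) (hxU : {x} ∈ U) (h : GotzmannOn (V.erase x) U) : GotzmannOn V U := by
  intro d
  cases d with
  | zero => exact card_upShadow_deg_zero_le _ _
  | succ d =>
    have hl : ∅ ∈ GotzmannEGF.link x U := by simpa [mem_link] using hxU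
    have hcV : #V = #(V.erase x) + 1 := by rw [card_erase_add_one hx]
    rw [card_upShadow_monsIn hU hx, card_monsIn_succ hx U d,
      monsIn_of_empty_mem (isUpperSet_link hU x) hl, monsIn_of_empty_mem (isUpperSet_link hU x) hl,
      upShadow_mons, union_eq_right.2 (monsIn_subset _ _ _), card_mons, card_mons, hcV,
      add_comm #(monsIn _ _ _), lexGrowth_add, multichoose_succ_succ']
    have := h (d + 1)
    omega

/-- Membership in `U` only depends on the elements in `V`. -/
def SupportedOn (V : Finset ι) (U : Set (Finset ι)) : Prop := ∀ s, s ∈ U ↔ s ∩ V ∈ U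

/-- The squarefree ideals obtained from the zero and the unit ideal by multiplying with new
variables and adding new variables. -/
inductive GotzmannClass : Set (Finset ι) → Prop
  | bot : GotzmannClass ∅
  | top : GotzmannClass Set.univ
  | mul (x : ι) (U : Set (Finset ι)) (hx : ∀ s, insert x s ∈ U → s ∈ U)
      (h : GotzmannClass U) : GotzmannClass {s | x ∈ s ∧ s ∈ U}
  | add (x : ι) (U : Set (Finset ι)) (hx : ∀ s, insert x s ∈ U → s ∈ U)
      (h : GotzmannClass U) : GotzmannClass {s | x ∈ s ∨ s ∈ U}

theorem GotzmannClass.isUpperSet {U : Set (Finset ι)} (h : GotzmannClass U) : IsUpperSet U := by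
  induction h with
  | bot => exact isUpperSet_empty
  | top => exact isUpperSet_univ
  | mul x U hx _ ih => exact fun s t hst hs => ⟨hst hs.1, ih hst hs.2⟩
  | add x U hx _ ih => exact fun s t hst hs => hs.imp (@hst x) (ih hst)

theorem GotzmannClass.gotzmannOn {U : Set (Finset ι)} (h : GotzmannClass U) :
    ∀ V, SupportedOn V U → GotzmannOn V U := by
  induction h with
  | bot => exact fun V _ => gotzmannOn_of_forall_notMem (by simp)
  | top => exact fun V _ => gotzmannOn_of_empty_mem isUpperSet_univ trivial
  | mul x U hx hc ih =>
    intro V hV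
    have hU := hc.isUpperSet
    have hiff : ∀ s, insert x s ∈ U ↔ s ∈ U := fun s => ⟨hx s, fun h => hU (subset_insert _ _) h⟩
    by_cases hxV : x ∈ V
    · refine GotzmannOn.of_link hxV (fun s hs => hs.1) (GotzmannOn.congr (ih V fun s => ?_) ?_)
      · have := hV (insert x s)
        simp only [Set.mem_ofPred_eq, mem_insert_self, true_and,
          insert_inter_of_mem hxV, hiff] at this
        exact this
      · intro s _
        simp [mem_link, hiff]
    -- When `V` lacks the new variable, the product has no member inside `V`; in the corresponding
    -- case for a sum, the ideal is the unit ideal.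
    · refine gotzmannOn_of_forall_notMem fun s hs h => ?_
      exact hxV (hs h.1)
  | add x U hx hc ih =>
    intro V hV
    have hU := hc.isUpperSet
    have hiff : ∀ s, insert x s ∈ U ↔ s ∈ U := fun s => ⟨hx s, fun h => hU (subset_insert _ _) h⟩
    have hup := (GotzmannClass.add x U hx hc).isUpperSet
    by_cases hxV : x ∈ V
    · refine GotzmannOn.of_erase hup hxV (by simp)
        (GotzmannOn.congr (ih (V.erase x) fun s => ?_) ?_)
      · have h1 := hV (s.erase x)
        simp only [Set.mem_ofPred_eq, mem_inter, mem_erase, ne_eq, not_true_eq_false, false_and,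
          false_or] at h1
        rw [← hiff (s.erase x), ← hiff (s.erase x ∩ V)] at h1
        rw [← hiff s, ← hiff (s ∩ V.erase x)]
        convert h1 using 2 <;> grind
      · intro s hs
        have : x ∉ s := fun h => (mem_erase.1 (hs h)).1 rfl
        simp [this]
    · refine gotzmannOn_of_empty_mem hup ?_
      have := (hV {x}).1 (by simp)
      rwa [singleton_inter_of_notMem hxV] at this

theorem SupportedOn.link {V : Finset ι} {U : Set (Finset ι)} (h : SupportedOn V U) (x : ι) :
    SupportedOn (V.erase x) (link x U) := by
  intro s
  rw [mem_link, mem_link, h, h (insert x (s ∩ V.erase x))]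
  have : insert x s ∩ V = insert x (s ∩ V.erase x) ∩ V := by grind
  rw [this]

theorem SupportedOn.preimage_erase {V : Finset ι} {U : Set (Finset ι)} (h : SupportedOn V U)
    (x : ι) : SupportedOn (V.erase x) {s | s.erase x ∈ U} := by
  intro s
  simp only [Set.mem_ofPred_eq]
  rw [h, h ((s ∩ V.erase x).erase x)]
  have : s.erase x ∩ V = (s ∩ V.erase x).erase x ∩ V := by grind
  rw [this]

/-- Variables are peeled off with `GotzmannOn.cases`, the quotient or remainder being Gotzmann on
fewer variables. -/
theorem GotzmannOn.gotzmannClass {V : Finset ι} {U : Set (Finset ι)} (h : GotzmannOn V U)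
    (hU : IsUpperSet U) (hV : SupportedOn V U) : GotzmannClass U := by
  induction hn : #V using Nat.strong_induction_on generalizing V U with
  | _ n ih =>
    rcases h.cases hU with h1 | h1 | ⟨y, hy, h1⟩ | ⟨y, hy, h1⟩
    · have : U = ∅ := Set.eq_empty_of_forall_notMem fun s hs =>
        h1 _ inter_subset_right ((hV s).1 hs)
      exact this ▸ .bot
    · have : U = Set.univ := Set.eq_univ_of_forall fun s => hU (empty_subset s) h1
      exact this ▸ .top
    · have hU' : IsUpperSet {s : Finset ι | s.erase y ∈ U} := fun s t hst hs =>
        hU (erase_subset_erase y hst) hs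
      -- The remainder is taken as a preimage under erasing `y`, so that it does not depend on `y`,
      -- as the constructor `add` demands.
      have heq : U = {s | y ∈ s ∨ s ∈ {s : Finset ι | s.erase y ∈ U}} := by
        ext s
        simp only [Set.mem_ofPred_eq]
        constructor
        · intro hs
          by_cases hys : y ∈ s
          · exact .inl hys
          · exact .inr (by rwa [erase_eq_of_notMem hys])
        · rintro (hs | hs)
          · exact hU (singleton_subset_iff.2 hs) h1
          · exact hU (erase_subset _ _) hs
      rw [heq]
      refine .add y _ (fun s hs => ?_) (ih _ (hn ▸ card_erase_lt_of_mem hy)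
        ((h.erase hU hy).congr fun s hs => ?_) hU' (hV.preimage_erase y) rfl)
      · simpa using hs
      · rw [Set.mem_ofPred_eq, erase_eq_of_notMem fun hys => (mem_erase.1 (hs hys)).1 rfl]
    · have heq : U = {s | y ∈ s ∧ s ∈ GotzmannEGF.link y U} := by
        ext s
        simp only [Set.mem_ofPred_eq, mem_link]
        constructor
        · exact fun hs => ⟨mem_of_mem_inter_left (h1 _ inter_subset_right ((hV s).1 hs)),
            hU (subset_insert _ _) hs⟩
        · rintro ⟨hy, hs⟩
          rwa [insert_eq_of_mem hy] at hs
      rw [heq]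
      refine .mul y _ (fun s hs => ?_) (ih _ (hn ▸ card_erase_lt_of_mem hy)
        (h.link hU hy) (isUpperSet_link hU y) (hV.link y) rfl)
      simpa [mem_link] using hs

theorem GotzmannClass.link {U : Set (Finset ι)} [Fintype ι] (h : GotzmannClass U) (x : ι) :
    GotzmannClass (link x U) := by
  have hs : SupportedOn univ U := fun s => by simp
  exact ((h.gotzmannOn univ hs).link h.isUpperSet (mem_univ x)).gotzmannClass
    (isUpperSet_link h.isUpperSet x) (hs.link x)

theorem gotzmannOn_univ_iff [Fintype ι] {U : Set (Finset ι)} (hU : IsUpperSet U) :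
    GotzmannOn univ U ↔ GotzmannClass U := by
  have hs : SupportedOn univ U := fun s => by simp
  exact ⟨fun h => h.gotzmannClass hU hs, fun h => h.gotzmannOn univ hs⟩

end Class

end GotzmannEGF

/-! ### Counting the class by its support. -/

namespace GotzmannEGF

open Finset

/-- The number of ideals of `GotzmannClass` with a given support of size `n` that contain no
variable; equivalently, that are not contained in the ideal generated by a variable. -/
def layerCount : ℕ → ℕ
  | 0 => 1
  | 1 => 0
  | n + 2 => ∑ j : Fin (n + 2), (n + 2).choose j * layerCount j

theorem layerCount_of_two_le {n : ℕ} (hn : 2 ≤ n) :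
    layerCount n = ∑ j ∈ range n, n.choose j * layerCount j := by
  obtain ⟨n, rfl⟩ := Nat.exists_eq_add_of_le' hn
  rw [layerCount, ← Fin.sum_univ_eq_sum_range (fun j => (n + 2).choose j * layerCount j)]

/-- Turns the sum over nonempty sets `B` of common variables into the recurrence; omitting `B = ∅`
removes the term `j = #V`. -/
theorem sum_powerset_sdiff_card {ι : Type*} [DecidableEq ι] (V : Finset ι) (f : ℕ → ℕ) :
    ∑ B ∈ V.powerset.erase ∅, f #(V \ B) = ∑ j ∈ range #V, (#V).choose j * f j := by
  have h1 : ∑ B ∈ V.powerset, f #(V \ B) = ∑ B ∈ V.powerset, f #B := by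
    refine sum_nbij' (V \ ·) (V \ ·) ?_ ?_ ?_ ?_ ?_
    · intro B _; exact mem_powerset.2 sdiff_subset
    · intro B _; exact mem_powerset.2 sdiff_subset
    · intro B hB; exact Finset.sdiff_sdiff_eq_self (mem_powerset.1 hB)
    · intro B hB; exact Finset.sdiff_sdiff_eq_self (mem_powerset.1 hB)
    · intro B _; rfl
  have h2 := sum_powerset_apply_card f (x := V)
  have h3 := add_sum_erase V.powerset (fun B => f #(V \ B)) (empty_mem_powerset V)
  rw [sum_range_succ, Nat.choose_self] at h2
  simp only [smul_eq_mul, one_mul, sdiff_empty] at h2 h3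
  omega

section Counting

variable {ι : Type*} [DecidableEq ι] [Fintype ι]

open Classical in
/-- The variables occurring in the minimal generators. -/
noncomputable def essential (U : Set (Finset ι)) : Finset ι :=
  univ.filter fun x => ∃ s, s ∉ U ∧ insert x s ∈ U

theorem mem_essential {U : Set (Finset ι)} {x : ι} :
    x ∈ essential U ↔ ∃ s, s ∉ U ∧ insert x s ∈ U := by simp [essential]

theorem mem_of_insert_mem {U : Set (Finset ι)} {x : ι} (hx : x ∉ essential U) {s : Finset ι}
    (hs : insert x s ∈ U) : s ∈ U := by
  by_contra h
  exact hx (mem_essential.2 ⟨s, h, hs⟩)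

theorem mem_of_union_mem {U : Set (Finset ι)} {B : Finset ι} (hB : Disjoint B (essential U))
    {s : Finset ι} (hs : s ∪ B ∈ U) : s ∈ U := by
  induction B using Finset.induction_on with
  | empty => simpa using hs
  | insert b B _ ih =>
    rw [disjoint_insert_left] at hB
    rw [union_insert] at hs
    exact ih hB.2 (mem_of_insert_mem hB.1 hs)

theorem supportedOn_essential {U : Set (Finset ι)} (hU : IsUpperSet U) :
    SupportedOn (essential U) U := by
  intro s
  refine ⟨fun hs => ?_, fun hs => hU inter_subset_left hs⟩
  refine mem_of_union_mem (B := s \ essential U) sdiff_disjoint ?_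
  rwa [union_comm, sdiff_union_inter]

/-- The ideal contains no variable and is proper. -/
def NoVariable (U : Set (Finset ι)) : Prop := ∅ ∉ U ∧ ∀ x, {x} ∉ U

/-- The ideal is nonzero and its members have no common variable. -/
def NoCommon (U : Set (Finset ι)) : Prop := univ ∈ U ∧ ∀ x, ∃ s ∈ U, x ∉ s

/-- Alexander duality. -/
def dual (U : Set (Finset ι)) : Set (Finset ι) := {s | sᶜ ∉ U}

theorem mem_dual {U : Set (Finset ι)} {s : Finset ι} : s ∈ dual U ↔ sᶜ ∉ U := Iff.rfl

theorem dual_dual (U : Set (Finset ι)) : dual (dual U) = U := by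
  ext s; simp [mem_dual]

theorem isUpperSet_dual {U : Set (Finset ι)} (hU : IsUpperSet U) : IsUpperSet (dual U) :=
  fun _ _ hst hs ht => hs (hU (compl_subset_compl.2 hst) ht)

theorem essential_dual_subset {U : Set (Finset ι)} (hU : IsUpperSet U) :
    essential (dual U) ⊆ essential U := by
  intro x hx
  obtain ⟨s, hs, hxs⟩ := mem_essential.1 hx
  rw [mem_dual, not_not] at hs
  rw [mem_dual] at hxs
  refine mem_essential.2 ⟨_, hxs, hU (fun j hj => ?_) hs⟩
  simp only [mem_insert, mem_compl] at hj ⊢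
  tauto

theorem essential_dual {U : Set (Finset ι)} (hU : IsUpperSet U) :
    essential (dual U) = essential U := by
  refine (essential_dual_subset hU).antisymm ?_
  conv_lhs => rw [← dual_dual U]
  exact essential_dual_subset (isUpperSet_dual hU)

/-- `{x}` lies outside the ideal exactly when `{x}ᶜ` lies in the dual, and `{x}ᶜ` is the largest set
avoiding `x`. -/
theorem noCommon_dual_iff {U : Set (Finset ι)} (hU : IsUpperSet U) :
    NoCommon (dual U) ↔ NoVariable U := by
  rw [NoCommon, NoVariable, mem_dual, compl_univ]
  refine and_congr_right fun _ => forall_congr' fun x => ⟨?_, fun h => ⟨{x}ᶜ, ?_, by simp⟩⟩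
  · rintro ⟨s, hs, hxs⟩ hx
    exact hs (hU (singleton_subset_iff.2 (mem_compl.2 hxs)) hx)
  · rwa [mem_dual, compl_compl]

theorem GotzmannClass.dual {U : Set (Finset ι)} (h : GotzmannClass U) :
    GotzmannClass (dual U) := by
  have hins : ∀ (x : ι) (U : Set (Finset ι)), IsUpperSet U → (∀ s, insert x s ∈ U → s ∈ U) →
      ∀ s, insert x s ∈ GotzmannEGF.dual U → s ∈ GotzmannEGF.dual U := by
    intro x U hU hx s hs hsU
    refine hs (hx _ (hU (fun j hj => ?_) hsU))
    simp only [mem_insert, mem_compl] at hj ⊢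
    tauto
  induction h with
  | bot => convert GotzmannClass.top (ι := ι); ext s; simp [mem_dual]
  | top => convert GotzmannClass.bot (ι := ι); ext s; simp [mem_dual]
  | mul x U hx hc ih =>
    convert GotzmannClass.add x _ (hins x U hc.isUpperSet hx) ih using 1
    ext s
    simp only [mem_dual, Set.mem_ofPred_eq, mem_compl]
    tauto
  | add x U hx hc ih =>
    convert GotzmannClass.mul x _ (hins x U hc.isUpperSet hx) ih using 1
    ext s
    simp only [mem_dual, Set.mem_ofPred_eq, mem_compl]
    tauto

open Classical in
/-- The members of `GotzmannClass` whose minimal generators involve exactly the variables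
in `V`. -/
noncomputable def classOn (V : Finset ι) : Finset (Set (Finset ι)) :=
  univ.filter fun U => GotzmannClass U ∧ essential U = V

theorem mem_classOn {V : Finset ι} {U : Set (Finset ι)} :
    U ∈ classOn V ↔ GotzmannClass U ∧ essential U = V := by simp [classOn]

-- Alexander duality is an involution preserving both the class and the support, and it exchanges
-- the two conditions.
open Classical in
theorem card_noCommon_eq (V : Finset ι) :
    #((classOn V).filter NoCommon) = #((classOn V).filter NoVariable) := by
  refine card_nbij' GotzmannEGF.dual GotzmannEGF.dual ?_ ?_ (fun U _ => dual_dual U)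
    (fun U _ => dual_dual U)
  · intro U hU
    simp only [coe_filter, Set.mem_ofPred_eq, mem_classOn] at hU ⊢
    have h := hU.1.1.isUpperSet
    refine ⟨⟨hU.1.1.dual, (essential_dual h).trans hU.1.2⟩, ?_⟩
    rw [← noCommon_dual_iff (isUpperSet_dual h), dual_dual]
    exact hU.2
  · intro U hU
    simp only [coe_filter, Set.mem_ofPred_eq, mem_classOn] at hU ⊢
    have h := hU.1.1.isUpperSet
    exact ⟨⟨hU.1.1.dual, (essential_dual h).trans hU.1.2⟩, (noCommon_dual_iff h).2 hU.2⟩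

theorem essential_of_empty_mem {U : Set (Finset ι)} (hU : IsUpperSet U) (h : ∅ ∈ U) :
    essential U = ∅ := by
  refine eq_empty_of_forall_notMem fun x hx => ?_
  obtain ⟨s, hs, -⟩ := mem_essential.1 hx
  exact hs (hU (empty_subset _) h)

theorem essential_principal (x : ι) : essential {s : Finset ι | x ∈ s} = {x} := by
  ext y
  rw [mem_essential, mem_singleton]
  constructor
  · rintro ⟨s, hs, hys⟩
    simp only [Set.mem_ofPred_eq, mem_insert] at hs hys
    exact (hys.resolve_right hs).symm
  · rintro rfl
    exact ⟨∅, by simp, by simp⟩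

/-- Apart from the ideals generated by a variable, exactly one of the two alternatives holds. -/
theorem GotzmannClass.noVariable_iff {U : Set (Finset ι)} (h : GotzmannClass U)
    (hc : #(essential U) ≠ 1) : NoVariable U ↔ ¬ NoCommon U := by
  cases h with
  | bot => simp [NoVariable, NoCommon]
  | top => simpa [NoVariable, NoCommon] using fun x => ⟨∅, by simp⟩
  | mul x U hx hcl =>
    refine iff_of_true ⟨by simp, ?_⟩ ?_
    · rintro y ⟨hxy, hyU⟩
      rw [mem_singleton] at hxy
      subst hxy
      have h0 : ∅ ∈ U := hx ∅ (by simpa using hyU)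
      apply hc
      have : {s : Finset ι | x ∈ s ∧ s ∈ U} = {s : Finset ι | x ∈ s} := by
        ext s
        simpa using fun _ => hcl.isUpperSet (empty_subset _) h0
      rw [this, essential_principal, card_singleton]
    · rintro ⟨-, h2⟩
      obtain ⟨s, hs, hxs⟩ := h2 x
      exact hxs hs.1
  | add x U hx hcl =>
    refine iff_of_false (fun h => h.2 x (by simp)) (not_not.2 ⟨by simp, fun y => ?_⟩)
    by_cases hyx : y = x
    · subst hyx
      by_contra hcon
      push Not at hcon
      apply hc
      have : {s : Finset ι | y ∈ s ∨ s ∈ U} = {s : Finset ι | y ∈ s} := by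
        ext s
        exact ⟨fun hs => hcon s hs, .inl⟩
      rw [this, essential_principal, card_singleton]
    · exact ⟨{x}, by simp, by simpa using hyx⟩

-- Off the one-variable case the two conditions are complementary, and duality makes them
-- equinumerous.
open Classical in
theorem card_classOn {V : Finset ι} (hV : #V ≠ 1) :
    #(classOn V) = 2 * #((classOn V).filter NoVariable) := by
  have h1 := card_filter_add_card_filter_not (s := classOn V) NoCommon
  have h2 : (classOn V).filter (fun U => ¬ NoCommon U) = (classOn V).filter NoVariable := by
    refine filter_congr fun U hU => ?_
    rw [mem_classOn] at hU
    exact (hU.1.noVariable_iff (hU.2 ▸ hV)).symm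
  rw [h2, card_noCommon_eq] at h1
  omega

theorem mem_classOn_singleton {x : ι} {U : Set (Finset ι)} :
    U ∈ classOn {x} ↔ U = {s | x ∈ s} := by
  rw [mem_classOn]
  constructor
  · rintro ⟨h, hx⟩
    have hU := h.isUpperSet
    have hs := supportedOn_essential hU
    rw [hx] at hs
    have h0 : ∅ ∉ U := fun h0 => by
      rw [essential_of_empty_mem hU h0] at hx
      exact singleton_ne_empty x hx.symm
    have h1 : {x} ∈ U := by
      have hxe : x ∈ essential U := by simp [hx]
      obtain ⟨s, -, hs'⟩ := mem_essential.1 hxe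
      rw [hs, insert_inter_of_mem (mem_singleton_self x)] at hs'
      exact hU (insert_subset (by simp) inter_subset_right) hs'
    ext s
    rw [hs, Set.mem_ofPred_eq]
    by_cases hxs : x ∈ s
    · rw [inter_singleton_of_mem hxs]; exact iff_of_true h1 hxs
    · rw [inter_singleton_of_notMem hxs]; exact iff_of_false h0 hxs
  · rintro rfl
    refine ⟨?_, essential_principal x⟩
    simpa using GotzmannClass.mul x Set.univ (by simp) .top

/-- The iterated colon by the variables in `B`. -/
def linkSet (B : Finset ι) (U : Set (Finset ι)) : Set (Finset ι) := {s | s ∪ B ∈ U}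

/-- The product with the variables in `B`. -/
def mulSet (B : Finset ι) (U : Set (Finset ι)) : Set (Finset ι) := {s | B ⊆ s ∧ s ∈ U}

theorem GotzmannClass.linkSet {U : Set (Finset ι)} (h : GotzmannClass U) (B : Finset ι) :
    GotzmannClass (linkSet B U) := by
  induction B using Finset.induction_on with
  | empty => simpa [GotzmannEGF.linkSet] using h
  | insert b B _ ih =>
    convert ih.link b using 1
    ext s
    simp [GotzmannEGF.linkSet, GotzmannEGF.link]

theorem GotzmannClass.mulSet {U : Set (Finset ι)} (h : GotzmannClass U) {B : Finset ι}
    (hB : Disjoint B (essential U)) : GotzmannClass (mulSet B U) := by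
  induction B using Finset.induction_on with
  | empty => simpa [GotzmannEGF.mulSet] using h
  | insert b B hb ih =>
    rw [disjoint_insert_left] at hB
    convert GotzmannClass.mul b _ (fun s hs => ?_) (ih hB.2) using 1
    · ext s
      simp [GotzmannEGF.mulSet, insert_subset_iff, and_assoc]
    · refine ⟨fun j hj => ?_, mem_of_insert_mem hB.1 hs.2⟩
      exact (mem_insert.1 (hs.1 hj)).resolve_left fun h => hb (h ▸ hj)

open Classical in
/-- The variables common to all members. -/
noncomputable def common (U : Set (Finset ι)) : Finset ι := univ.filter fun x => ∀ s ∈ U, x ∈ s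

theorem mem_common {U : Set (Finset ι)} {x : ι} : x ∈ common U ↔ ∀ s ∈ U, x ∈ s := by
  simp [common]

theorem common_subset_essential {U : Set (Finset ι)} (hU : IsUpperSet U) (h : U.Nonempty) :
    common U ⊆ essential U := by
  intro x hx
  rw [mem_common] at hx
  obtain ⟨s, hs⟩ := h
  refine mem_essential.2 ⟨s.erase x, fun h => notMem_erase x s (hx _ h), ?_⟩
  exact hU (subset_insert_iff.2 subset_rfl) hs

theorem essential_nonempty {U : Set (Finset ι)} (h : (essential U).Nonempty) : U.Nonempty := by
  obtain ⟨x, hx⟩ := h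
  obtain ⟨s, -, hs⟩ := mem_essential.1 hx
  exact ⟨_, hs⟩

theorem essential_linkSet {U : Set (Finset ι)} {B : Finset ι} (hB : B = common U) :
    essential (linkSet B U) = essential U \ B := by
  ext x
  rw [mem_sdiff, mem_essential, mem_essential]
  constructor
  · rintro ⟨s, hs, hxs⟩
    simp only [linkSet, Set.mem_ofPred_eq, insert_union] at hs hxs
    refine ⟨⟨_, hs, hxs⟩, fun hxB => hs ?_⟩
    rwa [insert_eq_of_mem (mem_union_right _ hxB)] at hxs
  · rintro ⟨⟨s, hs, hxs⟩, hxB⟩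
    have hBs : B ⊆ s := fun b hb => by
      have hb' : b ∈ insert x s := mem_common.1 (hB ▸ hb) _ hxs
      exact (mem_insert.1 hb').resolve_left fun h => hxB (h ▸ hb)
    refine ⟨s, ?_, ?_⟩ <;>
      simpa [linkSet, insert_union, union_eq_left.2 hBs]

theorem noCommon_linkSet {U : Set (Finset ι)} (hU : IsUpperSet U) (h : U.Nonempty) {B : Finset ι}
    (hB : B = common U) : NoCommon (linkSet B U) := by
  obtain ⟨s, hs⟩ := h
  refine ⟨hU ((subset_univ _).trans subset_union_left) hs, fun x => ?_⟩
  by_contra hcon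
  push Not at hcon
  have key : ∀ t ∈ U, x ∈ t \ B := by
    intro t ht
    refine hcon _ ?_
    have hBt : B ⊆ t := fun b hb => mem_common.1 (hB ▸ hb) _ ht
    simpa [linkSet, sdiff_union_of_subset hBt]
  have hxB : x ∈ B := hB ▸ mem_common.2 fun t ht => (mem_sdiff.1 (key t ht)).1
  exact (mem_sdiff.1 (key s hs)).2 hxB

theorem mulSet_linkSet {U : Set (Finset ι)} {B : Finset ι} (hB : B = common U) :
    mulSet B (linkSet B U) = U := by
  ext s
  simp only [mulSet, linkSet, Set.mem_ofPred_eq]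
  constructor
  · rintro ⟨h1, h2⟩
    rwa [union_eq_left.2 h1] at h2
  · intro hs
    have hBs : B ⊆ s := fun b hb => mem_common.1 (hB ▸ hb) _ hs
    exact ⟨hBs, by rwa [union_eq_left.2 hBs]⟩

theorem linkSet_mulSet {U : Set (Finset ι)} (hU : IsUpperSet U) {B : Finset ι}
    (hB : Disjoint B (essential U)) : linkSet B (mulSet B U) = U := by
  ext s
  simp only [mulSet, linkSet, Set.mem_ofPred_eq]
  exact ⟨fun h => mem_of_union_mem hB h.2, fun h => ⟨subset_union_right, hU subset_union_left h⟩⟩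

theorem essential_mulSet {U : Set (Finset ι)} (hU : IsUpperSet U) (h : univ ∈ U) {B : Finset ι}
    (hB : Disjoint B (essential U)) : essential (mulSet B U) = essential U ∪ B := by
  ext x
  rw [mem_union, mem_essential, mem_essential]
  constructor
  · rintro ⟨s, hs, hxs⟩
    by_cases hxB : x ∈ B
    · exact .inr hxB
    · left
      have hBs : B ⊆ s := fun b hb =>
        (mem_insert.1 (hxs.1 hb)).resolve_left fun h => hxB (h ▸ hb)
      exact ⟨s, fun h => hs ⟨hBs, h⟩, hxs.2⟩
  · rintro (⟨s, hs, hxs⟩ | hx)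
    · refine ⟨s ∪ B, fun h => hs (mem_of_union_mem hB h.2), ?_, ?_⟩
      · exact subset_union_right.trans (subset_insert _ _)
      · exact hU (insert_subset_insert _ subset_union_left) hxs
    · refine ⟨univ.erase x, fun h => notMem_erase x _ (h.1 hx), ?_⟩
      rw [insert_erase (mem_univ x)]
      exact ⟨subset_univ _, h⟩

theorem common_mulSet {U : Set (Finset ι)} (hU : IsUpperSet U) (h : NoCommon U) (B : Finset ι) :
    common (mulSet B U) = B := by
  ext x
  rw [mem_common]
  refine ⟨fun hx => ?_, fun hx s hs => hs.1 hx⟩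
  obtain ⟨s, hs, hxs⟩ := h.2 x
  exact (mem_union.1 (hx (s ∪ B) ⟨subset_union_right, hU subset_union_left hs⟩)).resolve_left hxs

-- Dividing by the product of the common variables leaves an ideal on the remaining support without
-- common variables, and multiplying back is inverse to this.
open Classical in
theorem card_filter_common {V B : Finset ι} (hBV : B ⊆ V) (hB : B.Nonempty) (hV : 2 ≤ #V) :
    #(((classOn V).filter NoVariable).filter fun U => common U = B) =
      #((classOn (V \ B)).filter NoCommon) := by
  have hVne : V.Nonempty := card_pos.1 (by omega)
  refine card_nbij' (linkSet B) (mulSet B) ?_ ?_ ?_ ?_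
  · intro U hU
    simp only [coe_filter, Set.mem_ofPred_eq, mem_filter, mem_classOn] at hU ⊢
    obtain ⟨⟨⟨hc, he⟩, -⟩, hcom⟩ := hU
    exact ⟨⟨hc.linkSet B, by rw [essential_linkSet hcom.symm, he]⟩,
      noCommon_linkSet hc.isUpperSet (essential_nonempty (he ▸ hVne)) hcom.symm⟩
  · intro U hU
    simp only [coe_filter, Set.mem_ofPred_eq, mem_filter, mem_classOn] at hU ⊢
    obtain ⟨⟨hc, he⟩, hcom⟩ := hU
    have hup := hc.isUpperSet
    have hdisj : Disjoint B (essential U) := by rw [he]; exact disjoint_sdiff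
    refine ⟨⟨⟨hc.mulSet hdisj, ?_⟩, fun h => ?_, fun x hx => ?_⟩, common_mulSet hup hcom B⟩
    · rw [essential_mulSet hup hcom.1 hdisj, he, sdiff_union_of_subset hBV]
    · exact hB.ne_empty (subset_empty.1 h.1)
    -- A variable in the product forces `B = {x}` and the other factor to be the unit ideal; then `V
    -- ⊆ B`, contrary to `2 ≤ #V`.
    · have hBx : B = {x} := (subset_singleton_iff.1 hx.1).resolve_left hB.ne_empty
      have h0 : ∅ ∈ U := mem_of_union_mem hdisj (by rw [empty_union, hBx]; exact hx.2)
      rw [essential_of_empty_mem hup h0, eq_comm, sdiff_eq_empty_iff_subset, hBx] at he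
      have := card_le_card he
      rw [card_singleton] at this
      omega
  · intro U hU
    simp only [coe_filter, Set.mem_ofPred_eq, mem_filter] at hU
    exact mulSet_linkSet hU.2.symm
  · intro U hU
    simp only [coe_filter, Set.mem_ofPred_eq, mem_classOn] at hU
    refine linkSet_mulSet hU.1.1.isUpperSet ?_
    rw [hU.1.2]; exact disjoint_sdiff

-- For at least two variables, sorting by the set `B` of common variables gives the recurrence. Each
-- fibre is counted on `V \ B` by ideals without common variables, which duality converts back to
-- the quantity under induction.
open Classical in
theorem card_filter_noVariable (V : Finset ι) :
    #((classOn V).filter NoVariable) = layerCount #V := by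
  induction hn : #V using Nat.strong_induction_on generalizing V with
  | _ n ih =>
    have h012 : n = 0 ∨ n = 1 ∨ 2 ≤ n := by omega
    rcases h012 with rfl | rfl | h2
    · rw [card_eq_zero] at hn
      subst hn
      rw [layerCount, card_eq_one]
      refine ⟨∅, ?_⟩
      ext U
      rw [mem_filter, mem_classOn, mem_singleton]
      constructor
      · rintro ⟨⟨hc, he⟩, hv⟩
        refine Set.eq_empty_of_forall_notMem fun s hs => hv.1 ?_
        have := (supportedOn_essential hc.isUpperSet s).1 hs
        rwa [he, inter_empty] at this
      · rintro rfl
        refine ⟨⟨.bot, eq_empty_of_forall_notMem fun x hx => ?_⟩, by simp [NoVariable]⟩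
        obtain ⟨s, -, hs⟩ := mem_essential.1 hx
        exact hs
    · obtain ⟨x, rfl⟩ := card_eq_one.1 hn
      rw [layerCount, card_eq_zero, filter_eq_empty_iff]
      intro U hU hv
      rw [mem_classOn_singleton] at hU
      subst hU
      exact hv.2 x (by simp)
    · rw [layerCount_of_two_le h2, ← hn, ← sum_powerset_sdiff_card V layerCount,
        card_eq_sum_card_fiberwise (f := common) (t := V.powerset.erase ∅)]
      · refine sum_congr rfl fun B hB => ?_
        rw [mem_erase, mem_powerset] at hB
        have hBne := nonempty_iff_ne_empty.2 hB.1
        rw [card_filter_common hB.2 hBne (hn ▸ h2), card_noCommon_eq]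
        refine ih _ ?_ _ rfl
        rw [← hn]
        exact card_lt_card (sdiff_ssubset hB.2 hBne)
      · intro U hU
        rw [mem_coe, mem_filter, mem_classOn] at hU
        obtain ⟨⟨hc, he⟩, hv⟩ := hU
        have hVne : V.Nonempty := card_pos.1 (by omega)
        rw [mem_coe, mem_erase, mem_powerset]
        refine ⟨fun h => ?_, he ▸ common_subset_essential hc.isUpperSet
          (essential_nonempty (he ▸ hVne))⟩
        -- An empty set of common variables would make both alternatives of
        -- `GotzmannClass.noVariable_iff` hold.
        have hnc : NoCommon U := by
          obtain ⟨s, hs⟩ := essential_nonempty (he ▸ hVne)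
          refine ⟨hc.isUpperSet (subset_univ _) hs, fun x => ?_⟩
          have : x ∉ common U := by simp [h]
          rw [mem_common] at this
          push Not at this
          exact this
        exact (hc.noVariable_iff (by rw [he]; omega)).1 hv hnc

/-- The number of members of `GotzmannClass` with support `V`. -/
theorem card_classOn_eq (V : Finset ι) :
    #(classOn V) = if #V = 1 then 1 else 2 * layerCount #V := by
  classical
  split_ifs with h
  · obtain ⟨x, rfl⟩ := card_eq_one.1 h
    rw [card_eq_one]
    exact ⟨{s | x ∈ s}, by ext U; rw [mem_classOn_singleton, mem_singleton]⟩
  · rw [card_classOn h, card_filter_noVariable]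

end Counting

end GotzmannEGF

/-! ### From ideals to sets of exponents. -/

namespace GotzmannEGF

open Finset MvPolynomial

attribute [local instance] MvPolynomial.gradedAlgebra

section Algebra

variable {k : Type*} [Field k] {n : ℕ}

theorem finrank_restrictSupport (A : Finset (Fin n →₀ ℕ)) :
    Module.finrank k (restrictSupport k (A : Set (Fin n →₀ ℕ))) = #A := by
  rw [Module.finrank_eq_card_basis (basisRestrictSupport k (A : Set (Fin n →₀ ℕ)))]
  simp

theorem homogeneousSubmodule_eq_restrictSupport (d : ℕ) :
    homogeneousSubmodule (Fin n) k d = restrictSupport k {a | a.degree = d} :=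
  homogeneousSubmodule_eq_finsupp_supported (Fin n) k d

open scoped Pointwise in
theorem linearMul_restrictSupport (A : Finset (Fin n →₀ ℕ)) :
    linearMul (restrictSupport k (A : Set (Fin n →₀ ℕ))) =
      restrictSupport k (upShadow univ A : Set (Fin n →₀ ℕ)) := by
  rw [linearMul, homogeneousSubmodule_eq_restrictSupport, ← restrictSupport_add]
  congr 1
  ext c
  rw [Set.mem_add, mem_coe, mem_upShadow, ← Finsupp.range_single_one]
  constructor
  · rintro ⟨_, ⟨i, rfl⟩, a, ha, rfl⟩
    exact ⟨a, ha, i, mem_univ i, add_comm _ _⟩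
  · rintro ⟨a, ha, i, -, rfl⟩
    exact ⟨_, ⟨i, rfl⟩, a, ha, add_comm _ _⟩

theorem mem_mons_univ {d : ℕ} {a : Fin n →₀ ℕ} : a ∈ mons univ d ↔ a.degree = d := by
  rw [mem_mons]
  simp

/-- The leading monomials of the elements of a space of forms of degree `d`. -/
noncomputable def leadingExponents (W : Submodule k (PolyRing k n)) (d : ℕ) :
    Finset (Fin n →₀ ℕ) :=
  open Classical in
  (mons univ d).filter fun a => ∃ f ∈ W, f ≠ 0 ∧ MonomialOrder.lex.degree f = a

theorem mem_leadingExponents {W : Submodule k (PolyRing k n)} {d : ℕ} {a : Fin n →₀ ℕ} :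
    a ∈ leadingExponents W d ↔
      a ∈ mons univ d ∧ ∃ f ∈ W, f ≠ 0 ∧ MonomialOrder.lex.degree f = a := by
  simp [leadingExponents]

theorem degree_mem_mons {d : ℕ} {f : PolyRing k n} (hf : f ∈ homogeneousSubmodule (Fin n) k d)
    (h0 : f ≠ 0) : MonomialOrder.lex.degree f ∈ mons univ d := by
  rw [homogeneousSubmodule_eq_restrictSupport, mem_restrictSupport_iff] at hf
  exact mem_mons_univ.2 (hf (MonomialOrder.lex.degree_mem_support h0))

theorem finite_of_le_homogeneousSubmodule {W : Submodule k (PolyRing k n)} {d : ℕ}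
    (hW : W ≤ homogeneousSubmodule (Fin n) k d) : Module.Finite k W := by
  have : Module.Finite k (homogeneousSubmodule (Fin n) k d) :=
    Module.Finite.iff_fg.2 (homogeneousSubmodule_fg (Fin n) k d)
  exact Submodule.finiteDimensional_of_le hW

/-- Reading off the coefficients at the leading exponents is injective: a nonzero form has a nonzero
leading coefficient. -/
theorem finrank_le_card_leadingExponents {W : Submodule k (PolyRing k n)} {d : ℕ}
    (hW : W ≤ homogeneousSubmodule (Fin n) k d) :
    Module.finrank k W ≤ #(leadingExponents W d) := by
  have := finite_of_le_homogeneousSubmodule hW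
  let φ : W →ₗ[k] (leadingExponents W d → k) :=
    LinearMap.pi fun a => (lcoeff k (a : Fin n →₀ ℕ)).comp W.subtype
  have hφ : Function.Injective φ := by
    rw [← LinearMap.ker_eq_bot, LinearMap.ker_eq_bot']
    rintro ⟨f, hf⟩ h
    by_contra hne
    have h0 : f ≠ 0 := fun h0 => hne (by simp [h0])
    have ha : MonomialOrder.lex.degree f ∈ leadingExponents W d :=
      mem_leadingExponents.2 ⟨degree_mem_mons (hW hf) h0, f, hf, h0, rfl⟩
    have := congrFun h ⟨_, ha⟩
    exact MonomialOrder.lex.coeff_degree_ne_zero_iff.2 h0 this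
  simpa using LinearMap.finrank_le_finrank_of_injective hφ

/-- Forms with distinct leading monomials are independent: the largest leading monomial in a
relation occurs only once. -/
theorem card_leadingExponents_le_finrank {W : Submodule k (PolyRing k n)} {d : ℕ}
    (hW : W ≤ homogeneousSubmodule (Fin n) k d) :
    #(leadingExponents W d) ≤ Module.finrank k W := by
  have := finite_of_le_homogeneousSubmodule hW
  have hex : ∀ a : leadingExponents W d, ∃ f : W, (f : PolyRing k n) ≠ 0 ∧
      MonomialOrder.lex.degree (f : PolyRing k n) = a := fun a => by
    obtain ⟨-, f, hf, h0, h⟩ := mem_leadingExponents.1 a.2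
    exact ⟨⟨f, hf⟩, h0, h⟩
  choose v hv0 hv using hex
  have hli : LinearIndependent k v := by
    classical
    rw [linearIndependent_iff']
    intro s c hsum
    by_contra hcon
    push Not at hcon
    obtain ⟨i, his, hi⟩ := hcon
    obtain ⟨j, hj, hmax⟩ := exists_max_image (s.filter fun i => c i ≠ 0)
      (fun i => MonomialOrder.lex.toSyn (i : Fin n →₀ ℕ)) ⟨i, mem_filter.2 ⟨his, hi⟩⟩
    rw [mem_filter] at hj
    have h1 := congrArg (fun f : W => coeff (j : Fin n →₀ ℕ) (f : PolyRing k n)) hsum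
    simp only [AddSubmonoidClass.coe_finsetSum, Submodule.coe_smul, coeff_sum, coeff_smul,
      Submodule.coe_zero, coeff_zero, smul_eq_mul] at h1
    rw [sum_eq_single_of_mem j hj.1] at h1
    · refine mul_ne_zero hj.2 ?_ h1
      rw [← hv j]
      exact MonomialOrder.lex.coeff_degree_ne_zero_iff.2 (hv0 j)
    · intro b hb hbj
      by_cases hcb : c b = 0
      · rw [hcb, zero_mul]
      · rw [MonomialOrder.lex.coeff_eq_zero_of_lt, mul_zero]
        rw [hv b]
        refine lt_of_le_of_ne (hmax b (mem_filter.2 ⟨hb, hcb⟩)) fun h => hbj ?_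
        exact Subtype.ext (MonomialOrder.lex.toSyn.injective h)
  simpa using hli.fintype_card_le_finrank

theorem linearMul_le {W : Submodule k (PolyRing k n)} {d : ℕ}
    (hW : W ≤ homogeneousSubmodule (Fin n) k d) :
    linearMul W ≤ homogeneousSubmodule (Fin n) k (d + 1) := by
  rw [add_comm]
  exact Submodule.mul_le.2 fun f hf g hg =>
    homogeneousSubmodule_mul 1 d (Submodule.mul_mem_mul hf (hW hg))

theorem upShadow_leadingExponents_subset {W : Submodule k (PolyRing k n)} {d : ℕ} :
    upShadow univ (leadingExponents W d) ⊆ leadingExponents (linearMul W) (d + 1) := by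
  intro c hc
  obtain ⟨a, ha, i, hi, rfl⟩ := mem_upShadow.1 hc
  obtain ⟨ha, f, hf, h0, hfa⟩ := mem_leadingExponents.1 ha
  refine mem_leadingExponents.2 ⟨(add_single_mem_mons hi).2 ha, X i * f,
    Submodule.mul_mem_mul (isHomogeneous_X k i) hf, mul_ne_zero (X_ne_zero i) h0, ?_⟩
  rw [MonomialOrder.degree_mul (X_ne_zero i) h0, MonomialOrder.degree_X, hfa, add_comm]

/-- Macaulay's bound for the growth of an arbitrary space of forms. -/
theorem lexGrowth_le_finrank_linearMul {W : Submodule k (PolyRing k n)} {d : ℕ}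
    (hW : W ≤ homogeneousSubmodule (Fin n) k d) :
    lexGrowth n d (Module.finrank k W) ≤ Module.finrank k (linearMul W) := by
  have h1 := lexGrowth_le_card_upShadow univ d (leadingExponents W d)
    fun a ha => (mem_leadingExponents.1 ha).1
  rw [card_univ, Fintype.card_fin] at h1
  exact ((lexGrowth_mono n d (finrank_le_card_leadingExponents hW)).trans h1).trans
    ((card_le_card upShadow_leadingExponents_subset).trans
      (card_leadingExponents_le_finrank (linearMul_le hW)))

theorem restrictSupportIdeal_eq_span {M : Set (Fin n →₀ ℕ)} (hM : IsUpperSet M) :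
    restrictSupportIdeal k M hM = Ideal.span ((fun a => monomial a (1 : k)) '' M) := by
  ext f
  rw [mem_ideal_span_monomial_image]
  change (f.support : Set (Fin n →₀ ℕ)) ⊆ M ↔ _
  exact ⟨fun h a ha => ⟨a, h ha, le_rfl⟩, fun h a ha => by
    obtain ⟨b, hb, hba⟩ := h a ha
    exact hM hba hb⟩

theorem isHomogeneous_restrictSupportIdeal {M : Set (Fin n →₀ ℕ)} (hM : IsUpperSet M) :
    (restrictSupportIdeal k M hM).IsHomogeneous (homogeneousSubmodule (Fin n) k) := by
  rw [restrictSupportIdeal_eq_span]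
  refine Ideal.homogeneous_span _ _ ?_
  rintro _ ⟨a, -, rfl⟩
  exact ⟨a.degree, isHomogeneous_monomial 1 rfl⟩

theorem component_restrictSupportIdeal {M : Set (Fin n →₀ ℕ)} (hM : IsUpperSet M) {d : ℕ}
    {A : Finset (Fin n →₀ ℕ)} (hA : ∀ a, a ∈ A ↔ a ∈ M ∧ a.degree = d) :
    component (restrictSupportIdeal k M hM) d =
      restrictSupport k (A : Set (Fin n →₀ ℕ)) := by
  ext f
  rw [component, restrictScalars_restrictSupportIdeal, homogeneousSubmodule_eq_restrictSupport,
    Submodule.mem_inf, mem_restrictSupport_iff, mem_restrictSupport_iff, mem_restrictSupport_iff]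
  constructor
  · rintro ⟨h1, h2⟩ a ha
    exact (hA a).2 ⟨h1 ha, h2 ha⟩
  · exact fun h => ⟨fun a ha => ((hA a).1 (h ha)).1, fun a ha => ((hA a).1 (h ha)).2⟩

theorem component_le (I : Ideal (PolyRing k n)) (d : ℕ) :
    component I d ≤ homogeneousSubmodule (Fin n) k d := inf_le_right

/-- The exponents of monomials with support in `U`. -/
def exponentsOf (U : Set (Finset (Fin n))) : Set (Fin n →₀ ℕ) := {a | a.support ∈ U}

theorem isUpperSet_exponentsOf {U : Set (Finset (Fin n))} (hU : IsUpperSet U) :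
    IsUpperSet (exponentsOf U) :=
  fun _ _ hab ha => hU (Finsupp.support_mono hab) ha

/-- The squarefree monomial ideal spanned by the monomials with support in `U`. -/
noncomputable def squarefreeIdeal (k : Type*) [Field k] {U : Set (Finset (Fin n))}
    (hU : IsUpperSet U) : Ideal (PolyRing k n) :=
  restrictSupportIdeal k (exponentsOf U) (isUpperSet_exponentsOf hU)

theorem component_squarefreeIdeal {U : Set (Finset (Fin n))} (hU : IsUpperSet U) (d : ℕ) :
    component (squarefreeIdeal k hU) d =
      restrictSupport k (monsIn univ U d : Set (Fin n →₀ ℕ)) := by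
  refine component_restrictSupportIdeal _ fun a => ?_
  rw [mem_monsIn, mem_mons_univ, and_comm]
  rfl

/-- In one direction the competitor is the ideal generated by a lexicographic segment, whose layer
in that degree is the segment itself. In the other, Macaulay's bound applies to every competitor. -/
theorem isGotzmann_squarefreeIdeal_iff {U : Set (Finset (Fin n))} (hU : IsUpperSet U) :
    IsGotzmann (squarefreeIdeal k hU) ↔ GotzmannOn univ U := by
  have hcard : ∀ d, Module.finrank k (component (squarefreeIdeal k hU) d) =
      #(monsIn univ U d) := fun d => by
    rw [component_squarefreeIdeal, finrank_restrictSupport]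
  have hcard' : ∀ d, Module.finrank k (linearMul (component (squarefreeIdeal k hU) d)) =
      #(upShadow univ (monsIn univ U d)) := fun d => by
    rw [component_squarefreeIdeal, linearMul_restrictSupport, finrank_restrictSupport]
  have hn : #(univ : Finset (Fin n)) = n := by simp
  constructor
  · rintro ⟨-, h⟩ d
    have hle : #(monsIn univ U d) ≤ Nat.multichoose #(univ : Finset (Fin n)) d :=
      card_le_multichoose (monsIn_subset _ _ _)
    set S := lexSeg (univ : Finset (Fin n)) d #(monsIn univ U d) with hS
    have hM : IsUpperSet {b : Fin n →₀ ℕ | ∃ a ∈ S, a ≤ b} := by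
      rintro b c hbc ⟨a, ha, hab⟩
      exact ⟨a, ha, hab.trans hbc⟩
    have hcomp : component (restrictSupportIdeal k _ hM) d =
        restrictSupport k (S : Set (Fin n →₀ ℕ)) := by
      refine component_restrictSupportIdeal hM fun a => ⟨fun ha => ⟨⟨a, ha, le_rfl⟩, ?_⟩, ?_⟩
      · exact mem_mons_univ.1 (lexSeg_subset _ _ _ ha)
      · rintro ⟨⟨b, hb, hba⟩, had⟩
        have hbd := mem_mons_univ.1 (lexSeg_subset _ _ _ hb)
        obtain ⟨c, rfl⟩ := exists_add_of_le hba
        rw [map_add, hbd] at had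
        have : c = 0 := (Finsupp.degree_eq_zero_iff c).1 (by omega)
        simpa [this] using hb
    have := h d _ (isHomogeneous_restrictSupportIdeal hM)
      (by rw [hcard, hcomp, finrank_restrictSupport, hS, card_lexSeg hle])
    rwa [hcard', hcomp, linearMul_restrictSupport, finrank_restrictSupport, hS,
      card_upShadow_lexSeg hle] at this
  · intro h
    refine ⟨isHomogeneous_restrictSupportIdeal _, fun d J _ hJ => ?_⟩
    have h1 := lexGrowth_le_finrank_linearMul (component_le J d)
    have h2 := h d
    rw [hn] at h2
    rw [hcard] at hJ
    rw [hcard']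
    rw [← hJ] at h1
    exact h2.trans h1

theorem monomial_mem_squarefreeIdeal {U : Set (Finset (Fin n))} (hU : IsUpperSet U)
    {a : Fin n →₀ ℕ} : monomial a (1 : k) ∈ squarefreeIdeal k hU ↔ a.support ∈ U := by
  change monomial a (1 : k) ∈ restrictSupport k (exponentsOf U) ↔ _
  rw [monomial_mem_restrictSupport]
  simp [exponentsOf]

/-- The squarefree exponent with support `s`. -/
noncomputable def squarefreeExponent (s : Finset (Fin n)) : Fin n →₀ ℕ :=
  ∑ i ∈ s, Finsupp.single i 1

theorem squarefreeExponent_apply (s : Finset (Fin n)) (i : Fin n) :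
    squarefreeExponent s i = if i ∈ s then 1 else 0 := by
  simp [squarefreeExponent, Finsupp.finsetSum_apply, Finsupp.single_apply]

@[simp] theorem support_squarefreeExponent (s : Finset (Fin n)) :
    (squarefreeExponent s).support = s := by
  ext i
  simp [squarefreeExponent_apply]

theorem squarefreeExponent_le {s : Finset (Fin n)} {a : Fin n →₀ ℕ} (h : s ⊆ a.support) :
    squarefreeExponent s ≤ a := by
  intro i
  rw [squarefreeExponent_apply]
  split_ifs with hi
  · exact Nat.one_le_iff_ne_zero.2 (Finsupp.mem_support_iff.1 (h hi))
  · exact Nat.zero_le _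

theorem le_squarefreeExponent {s : Finset (Fin n)} {a : Fin n →₀ ℕ} (h : a.support ⊆ s)
    (h1 : ∀ i, a i ≤ 1) : a ≤ squarefreeExponent s := by
  intro i
  rw [squarefreeExponent_apply]
  split_ifs with hi
  · exact h1 i
  · exact (Finsupp.notMem_support_iff.1 fun h' => hi (h h')).le

theorem isSquarefreeIdeal_squarefreeIdeal {U : Set (Finset (Fin n))} (hU : IsUpperSet U) :
    IsSquarefreeIdeal (squarefreeIdeal k hU) := by
  refine ⟨⟨_, restrictSupportIdeal_eq_span _⟩, fun a ha i => ?_⟩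
  obtain ⟨h1, h2⟩ := ha
  have h3 := h2 (y := squarefreeExponent a.support) (by
    simp only [monomial_mem_squarefreeIdeal] at h1 ⊢
    rwa [support_squarefreeExponent]) (squarefreeExponent_le subset_rfl) i
  rw [squarefreeExponent_apply] at h3
  split_ifs at h3 <;> omega

theorem monomial_mem_mono {I : Ideal (PolyRing k n)} {a b : Fin n →₀ ℕ} (hab : a ≤ b)
    (ha : monomial a (1 : k) ∈ I) : monomial b (1 : k) ∈ I := by
  obtain ⟨c, rfl⟩ := exists_add_of_le hab
  rw [add_comm, show monomial (c + a) (1 : k) = monomial c 1 * monomial a 1 by simp]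
  exact I.mul_mem_left _ ha

/-- A squarefree minimal generator divides a monomial as soon as its support is contained in that of
the monomial, so membership of monomials depends on supports alone. -/
theorem IsSquarefreeIdeal.exists_eq {I : Ideal (PolyRing k n)} (h : IsSquarefreeIdeal I) :
    ∃ (U : Set (Finset (Fin n))) (hU : IsUpperSet U), I = squarefreeIdeal k hU := by
  obtain ⟨⟨A, hA⟩, hsq⟩ := h
  have hU : IsUpperSet {s : Finset (Fin n) | monomial (squarefreeExponent s) (1 : k) ∈ I} := by
    intro s t hst hs
    exact monomial_mem_mono (squarefreeExponent_le (by simpa using hst)) hs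
  refine ⟨_, hU, ?_⟩
  have key : ∀ a, monomial a (1 : k) ∈ I ↔ monomial (squarefreeExponent a.support) (1 : k) ∈ I := by
    refine fun a => ⟨fun ha => ?_, monomial_mem_mono (squarefreeExponent_le subset_rfl)⟩
    obtain ⟨g, hga, hg⟩ := exists_minimal_le_of_wellFoundedLT
      (fun b => monomial b (1 : k) ∈ I) a ha
    exact monomial_mem_mono (le_squarefreeExponent (Finsupp.support_mono hga) (hsq g hg)) hg.1
  ext f
  have h1 : f ∈ I ↔ ∀ a ∈ f.support, monomial a (1 : k) ∈ I := by
    constructor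
    · intro hf a ha
      rw [hA, mem_ideal_span_monomial_image] at hf
      obtain ⟨b, hb, hba⟩ := hf a ha
      exact monomial_mem_mono hba (hA ▸ Ideal.subset_span ⟨b, hb, rfl⟩)
    · intro hf
      rw [f.as_sum]
      refine I.sum_mem fun a ha => ?_
      rw [show monomial a (coeff a f) = C (coeff a f) * monomial a 1 by simp [C_mul_monomial]]
      exact I.mul_mem_left _ (hf a ha)
  rw [h1]
  exact forall₂_congr fun a _ => key a

theorem squarefreeIdeal_injective {U U' : Set (Finset (Fin n))} (hU : IsUpperSet U)
    (hU' : IsUpperSet U') (h : squarefreeIdeal k hU = squarefreeIdeal k hU') : U = U' := by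
  ext s
  rw [← support_squarefreeExponent s, ← monomial_mem_squarefreeIdeal (k := k) hU, h,
    monomial_mem_squarefreeIdeal]

theorem hasFullSupport_squarefreeIdeal_iff {U : Set (Finset (Fin n))} (hU : IsUpperSet U) :
    HasFullSupport (squarefreeIdeal k hU) ↔ essential U = univ := by
  rw [eq_univ_iff_forall, HasFullSupport]
  refine forall_congr' fun i => ?_
  rw [mem_essential]
  constructor
  · rintro ⟨a, ⟨h1, h2⟩, hi⟩
    simp only [monomial_mem_squarefreeIdeal] at h1 h2
    refine ⟨a.support.erase i, fun h => ?_, by rwa [insert_erase hi]⟩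
    have := h2 (y := squarefreeExponent (a.support.erase i)) (by
      simpa using h) (squarefreeExponent_le (erase_subset _ _)) i
    rw [squarefreeExponent_apply, if_neg (notMem_erase i _)] at this
    exact Finsupp.mem_support_iff.1 hi (Nat.le_zero.1 this)
  · rintro ⟨s, hs, his⟩
    obtain ⟨g, hgs, hg⟩ := exists_minimal_le_of_wellFoundedLT
      (fun b => monomial b (1 : k) ∈ squarefreeIdeal k hU) (squarefreeExponent (insert i s))
      (by rw [monomial_mem_squarefreeIdeal]; simpa using his)
    refine ⟨g, hg, ?_⟩
    -- A minimal generator below `insert i s` that avoids `i` would be supported in `s`, putting `s`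
    -- in `U`.
    by_contra hig
    have hsub : g.support ⊆ insert i s := by simpa using Finsupp.support_mono hgs
    exact hs (hU ((subset_insert_iff_of_notMem hig).1 hsub)
      ((monomial_mem_squarefreeIdeal hU).1 hg.1))

theorem mem_fullSupportGotzmann_iff {I : Ideal (PolyRing k n)} :
    (⟨n, I⟩ : Σ n : ℕ, Ideal (PolyRing k n)) ∈ fullSupportGotzmann k ↔
      ∃ U ∈ classOn (univ : Finset (Fin n)), ∃ hU : IsUpperSet U, I = squarefreeIdeal k hU := by
  constructor
  · intro h
    obtain ⟨h1, h2, h3⟩ : IsSquarefreeIdeal I ∧ IsGotzmann I ∧ HasFullSupport I := h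
    obtain ⟨U, hU, rfl⟩ := IsSquarefreeIdeal.exists_eq h1
    refine ⟨U, mem_classOn.2 ⟨?_, (hasFullSupport_squarefreeIdeal_iff hU).1 h3⟩, hU, rfl⟩
    exact (gotzmannOn_univ_iff hU).1 ((isGotzmann_squarefreeIdeal_iff hU).1 h2)
  · rintro ⟨U, hUc, hU, rfl⟩
    rw [mem_classOn] at hUc
    exact ⟨isSquarefreeIdeal_squarefreeIdeal hU,
      (isGotzmann_squarefreeIdeal_iff hU).2 ((gotzmannOn_univ_iff hU).2 hUc.1),
      (hasFullSupport_squarefreeIdeal_iff hU).2 hUc.2⟩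

/-- The ideal of `k[x₁, …, xₙ]` attached to a family of supports. -/
noncomputable def weightedIdeal (k : Type*) [Field k] (U : Set (Finset (Fin n))) :
    Σ n : ℕ, Ideal (PolyRing k n) :=
  ⟨n, Ideal.span ((fun a => monomial a (1 : k)) '' exponentsOf U)⟩

theorem weightedIdeal_eq {U : Set (Finset (Fin n))} (hU : IsUpperSet U) :
    weightedIdeal k U = ⟨n, squarefreeIdeal k hU⟩ := by
  rw [weightedIdeal, squarefreeIdeal, restrictSupportIdeal_eq_span]

theorem fullSupportGotzmann_weight_eq (n : ℕ) :
    {I ∈ fullSupportGotzmann k | weight I = n} =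
      weightedIdeal k '' (classOn (univ : Finset (Fin n)) : Set (Set (Finset (Fin n)))) := by
  ext ⟨m, I⟩
  constructor
  · rintro ⟨h, rfl⟩
    obtain ⟨U, hUc, hU, rfl⟩ := mem_fullSupportGotzmann_iff.1 h
    exact ⟨U, hUc, weightedIdeal_eq hU⟩
  · rintro ⟨U, hUc, h⟩
    have hU := (mem_classOn.1 hUc).1.isUpperSet
    rw [weightedIdeal_eq hU] at h
    rw [← h]
    exact ⟨mem_fullSupportGotzmann_iff.2 ⟨U, hUc, hU, rfl⟩, rfl⟩

theorem finite_fullSupportGotzmann_weight (n : ℕ) :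
    {I ∈ fullSupportGotzmann k | weight I = n}.Finite := by
  rw [fullSupportGotzmann_weight_eq]
  exact (finite_toSet _).image _

theorem ncard_fullSupportGotzmann_weight (n : ℕ) :
    {I ∈ fullSupportGotzmann k | weight I = n}.ncard =
      if n = 1 then 1 else 2 * layerCount n := by
  have hinj : Set.InjOn (weightedIdeal k)
      (classOn (univ : Finset (Fin n)) : Set (Set (Finset (Fin n)))) := by
    intro U hU U' hU' h
    have h1 := (mem_classOn.1 hU).1.isUpperSet
    have h2 := (mem_classOn.1 hU').1.isUpperSet
    rw [weightedIdeal_eq h1, weightedIdeal_eq h2] at h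
    exact squarefreeIdeal_injective h1 h2 (eq_of_heq (Sigma.mk.inj h).2)
  rw [fullSupportGotzmann_weight_eq, hinj.ncard_image, Set.ncard_coe_finset,
    card_classOn_eq, card_univ, Fintype.card_fin]

end Algebra

/-! ### The generating function. -/

section GeneratingFunction

open PowerSeries in
/-- The exponential generating function of `layerCount`. -/
theorem layerCount_egf_mul :
    (PowerSeries.mk fun n => (layerCount n : ℚ) / n.factorial) * (2 - exp ℚ) =
      1 - PowerSeries.X := by
  ext n
  have hmul : PowerSeries.coeff n
      ((PowerSeries.mk fun n => (layerCount n : ℚ) / n.factorial) * exp ℚ) =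
      (∑ j ∈ range (n + 1), (n.choose j * layerCount j : ℕ) : ℚ) / n.factorial := by
    rw [PowerSeries.coeff_mul, Finset.Nat.sum_antidiagonal_eq_sum_range_succ_mk, sum_div]
    refine sum_congr rfl fun j hj => ?_
    have hjn : j ≤ n := Nat.lt_succ_iff.1 (mem_range.1 hj)
    simp only [PowerSeries.coeff_mk, coeff_exp]
    push_cast
    rw [Nat.cast_choose ℚ hjn]
    have h1 : (n.factorial : ℚ) ≠ 0 := by positivity
    have h2 : (j.factorial : ℚ) ≠ 0 := by positivity
    have h3 : ((n - j).factorial : ℚ) ≠ 0 := by positivity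
    simp
    field_simp
  rw [mul_sub, mul_two, map_sub, map_add, hmul, PowerSeries.coeff_mk, map_sub,
    PowerSeries.coeff_one, PowerSeries.coeff_X]
  -- The recurrence makes the coefficients vanish from `n = 2` on; the exceptional values at 0 and 1
  -- produce `1 - X`.
  have h012 : n = 0 ∨ n = 1 ∨ 2 ≤ n := by omega
  rcases h012 with rfl | rfl | h2
  · simp [layerCount]
  · simp [layerCount, sum_range_succ]
  · rw [sum_range_succ, ← Nat.cast_sum, ← layerCount_of_two_le h2, Nat.choose_self, one_mul,
      if_neg (by omega), if_neg (by omega)]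
    ring

theorem constantCoeff_two_sub_exp : PowerSeries.constantCoeff (2 - PowerSeries.exp ℚ) ≠ 0 := by
  rw [map_sub, PowerSeries.constantCoeff_exp, map_ofNat]
  norm_num

/-- The term `X` accounts for the ideal generated by the variable when `n = 1`, where `layerCount`
is zero and the doubling fails. -/
theorem egf_fullSupportGotzmann (k : Type*) [Field k] :
    egf (fullSupportGotzmann k) weight =
      2 * (PowerSeries.mk fun n => (layerCount n : ℚ) / n.factorial) + PowerSeries.X := by
  ext n
  rw [two_mul, map_add, map_add, PowerSeries.coeff_mk, PowerSeries.coeff_X, egf,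
    PowerSeries.coeff_mk, ncard_fullSupportGotzmann_weight]
  split_ifs with h
  · subst h
    simp [layerCount]
  · push_cast
    ring

end GeneratingFunction

end GotzmannEGF

theorem mainTheorem7 (k : Type*) [Field k] :
    (∀ n : ℕ, {I ∈ GotzmannEGF.fullSupportGotzmann k | GotzmannEGF.weight I = n}.Finite) ∧
    GotzmannEGF.egf (GotzmannEGF.fullSupportGotzmann k) GotzmannEGF.weight =
      2 * (1 - PowerSeries.X) * (2 - PowerSeries.exp ℚ)⁻¹ + PowerSeries.X := by
  refine ⟨GotzmannEGF.finite_fullSupportGotzmann_weight, ?_⟩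
  rw [GotzmannEGF.egf_fullSupportGotzmann, ← GotzmannEGF.layerCount_egf_mul, mul_assoc,
    mul_assoc, PowerSeries.mul_inv_cancel _ GotzmannEGF.constantCoeff_two_sub_exp, mul_one]
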